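/- Let $X=(X,d,\mathfrak m)$ be a metric measure space: $(X,d)$ is a complete separable metric space and $\mathfrak m$ is a Borel measure which is finite on bounded sets. **Definitions.** For $U\subset X$, $f\colon X\to\mathbb R$ and $x\in U$ let $$\mathrm{lip}(f|_U)(x)=\limsup_{U\ni y\to x,\ y\neq x}\frac{|f(y)-f(x)|}{d(y,x)}$$ if $x$ is an accumulation point of $U$, and $\mathrm{lip}(f|_U)(x)=0$ otherwise. A *(weak) chart* of dimension $k\in\mathbb N=\{0,1,2,\dots\}$ is a pair $(U,\varphi)$ of a Borel set $U\subset X$ with $\mathfrak m(U)>0$ and a Lipschitz map $\varphi\colon X\to\mathbb R^k$ such that for every Lipschitz $f\colon X\to\mathbb R$ and $\mathfrak m$-a.e. $x\in U$ there is a unique linear map $\mathrm d_xf\colon\mathbb R^k\to\mathbb R$ with $\mathrm{lip}\big((f-\mathrm d_xf\circ\varphi)|_U\big)(x)=0$. An *atlas* is a countable family $\mathscr A=\{(U_i,\varphi_i)\}_i$ of weak charts, of dimensions $k_i$, whose domains $U_i$ are pairwise disjoint and cover $X$ up to an $\mathfrak m$-null set. Its tangent bundle is $T_{\mathscr A}X=\bigsqcup_i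 U_i\times\mathbb R^{k_i}$, where for $\mathfrak m$-a.e. $x\in U_i$ the fiber over $x$ carries the norm $$|\xi|_{\mathscr A,x}=\sup\big\{L(\xi):\ L\in(\mathbb R^{k_i})^*,\ \mathrm{lip}(L\circ\varphi_i|_{U_i})(x)\le 1\big\},$$ and $\Gamma_2(T_{\mathscr A}X)$ is the space of measurable sections $v$ of $T_{\mathscr A}X$, modulo $\mathfrak m$-a.e. equality, with $\int_X|v|_{\mathscr A}^2\,d\mathfrak m<\infty$. This is the concrete tangent module $\Gamma_2(TX)$. A *rectifiable chart* of dimension $k$ is a pair $(U,\varphi)$ of a Borel set $U\subset X$ and a bi-Lipschitz embedding $\varphi\colon U\to\mathbb R^k$ such that $\mathfrak m|_U\ll\mathcal H^k|_U$. It is $(1+\varepsilon)$-bi-Lipschitz if $(1+\varepsilon)^{-1}d(x,y)\le|\varphi(x)-\varphi(y)|\le(1+\varepsilon)d(x,y)$ for all $x,y\in U$. The space $X$ admits a *strongly rectifiable decomposition* if for every $\varepsilon>0$ it can be covered, up to an $\mathfrak m$-null set, by countably many $(1+\varepsilon)$-bi-Lipschitz rectifiable charts of arbitrary dimensions. A *dimensional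 decomposition* of $X$ is a family $(A_k)_{k\in\mathbb N}$ of pairwise disjoint Borel sets covering $X$ up to an $\mathfrak m$-null set such that each $\mathfrak m|_{A_k}$ is $k$-rectifiable, i.e. $A_k$ is covered up to an $\mathfrak m$-null set by countably many $k$-dimensional rectifiable charts. The Gromov–Hausdorff tangent bundle is $T_{GH}X=\bigsqcup_{k}A_k\times\mathbb R^k$ with the Euclidean norm on each fiber, and the Gromov–Hausdorff tangent module $L^2(T_{GH}X)$ is the space of measurable sections $v$ of $T_{GH}X$, modulo $\mathfrak m$-a.e. equality, with $\int_X|v|^2\,d\mathfrak m<\infty$. Both spaces are modules over $L^\infty(\mathfrak m)$ under pointwise multiplication, and carry the pointwise norm $|v|(x)=|v(x)|$. An *isometric isomorphism of normed modules* between them is an $L^\infty(\mathfrak m)$-linear bijection $I$ with $|I(v)|=|v|$ $\mathfrak m$-a.e. for every $v$. **Theorem 1.5.** If $X$ admits a strongly rectifiable decomposition, then $X$ admits an atlas and a dimensional decomposition, and for every atlas $\mathscr A$ and every dimensional decomposition $(A_k)_k$ of $X$, the concrete tangent module $\Gamma_2(T_{\mathscr A}X)$ and the Gromov–Hausdorff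 tangent module $L^2(T_{GH}X)$ are isometrically isomorphic as normed modules. -/

import Mathlib

open MeasureTheory Filter Topology Set
open scoped ENNReal

noncomputable section

namespace ConcreteTangent

/-- Euclidean `n`-space with its Euclidean norm. -/
abbrev Euc (n : ℕ) : Type := EuclideanSpace ℝ (Fin n)

section Lip

variable {X : Type*} [MetricSpace X]

/-- The pointwise Lipschitz constant `lip (f|_U) (x)`:
the upper limit of `|f y - f x| / d(y, x)` as `y → x`, `y ∈ U`, `y ≠ x`.
If `x` is not an accumulation point of `U` the filter is trivial and the value is `0`. -/
def lipWithin (U : Set X) (f : X → ℝ) (x : X) : ℝ≥0∞ :=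
  limsup (fun y => edist (f y) (f x) / edist y x) (𝓝[U \ {x}] x)

/-- The norm `|L|*_x = lip (L ∘ φ|_U) (x)` of a covector in the chart `(U, φ)`. -/
def cotangentNorm {k : ℕ} (U : Set X) (φ : X → Euc k) (x : X) (L : Euc k →L[ℝ] ℝ) : ℝ≥0∞ :=
  lipWithin U (fun y => L (φ y)) x

/-- The norm on tangent vectors dual to `cotangentNorm`. -/
def tangentNorm {k : ℕ} (U : Set X) (φ : X → Euc k) (x : X) (ξ : Euc k) : ℝ≥0∞ :=
  ⨆ (L : Euc k →L[ℝ] ℝ) (_ : cotangentNorm U φ x L ≤ 1), ENNReal.ofReal (L ξ)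

theorem measurable_lipWithin [MeasurableSpace X] [BorelSpace X] (U : Set X) {f : X → ℝ}
    (hf : Continuous f) : Measurable (lipWithin U f) := by
  have key : lipWithin U f = fun x => ⨅ n : ℕ, ⨆ y : X,
      {x | y ∈ U ∧ x ≠ y ∧ dist x y < 1 / ((n : ℝ) + 1)}.indicator
        (fun x => edist (f y) (f x) / edist y x) x := by
    funext x
    have hb : (𝓝[U \ {x}] x).HasBasis (fun _ : ℕ => True)
        (fun n => Metric.ball x (1 / ((n : ℝ) + 1)) ∩ (U \ {x})) :=
      nhdsWithin_hasBasis Metric.nhds_basis_ball_inv_nat_succ _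
    rw [lipWithin, hb.limsup_eq_iInf_iSup]
    simp only [iInf_pos]
    refine iInf_congr fun n => iSup_congr fun y => ?_
    by_cases hy : y ∈ Metric.ball x (1 / ((n : ℝ) + 1)) ∩ (U \ {x})
    · have hx : x ∈ {x | y ∈ U ∧ x ≠ y ∧ dist x y < 1 / ((n : ℝ) + 1)} :=
        ⟨hy.2.1, fun h => hy.2.2 h.symm, by rw [dist_comm]; exact hy.1⟩
      rw [iSup_pos hy, indicator_of_mem hx]
    · have hx : x ∉ {x | y ∈ U ∧ x ≠ y ∧ dist x y < 1 / ((n : ℝ) + 1)} := by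
        rintro ⟨h1, h2, h3⟩
        exact hy ⟨by rw [Metric.mem_ball, dist_comm]; exact h3, h1, fun h => h2 h.symm⟩
      rw [iSup_neg hy, indicator_of_notMem hx]; rfl
  rw [key]
  refine Measurable.iInf fun n => LowerSemicontinuous.measurable ?_
  refine lowerSemicontinuous_iSup fun y => ?_
  rw [lowerSemicontinuous_iff_isOpen_preimage]
  intro a
  have hO : IsOpen {x | y ∈ U ∧ x ≠ y ∧ dist x y < 1 / ((n : ℝ) + 1)} :=
    isOpen_const.and (isOpen_ne.and
      (isOpen_lt (continuous_id.dist continuous_const) continuous_const))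
  have hc : ContinuousOn (fun x => edist (f y) (f x) / edist y x)
      {x | y ∈ U ∧ x ≠ y ∧ dist x y < 1 / ((n : ℝ) + 1)} := by
    intro x hx
    refine ContinuousAt.continuousWithinAt ?_
    refine ENNReal.Tendsto.div (Continuous.tendsto (by fun_prop) x) (Or.inr ?_)
      (Continuous.tendsto (by fun_prop) x) (Or.inl (edist_ne_top _ _))
    simpa [edist_eq_zero] using hx.2.1.symm
  have he : (fun x => {x | y ∈ U ∧ x ≠ y ∧ dist x y < 1 / ((n : ℝ) + 1)}.indicator
        (fun x => edist (f y) (f x) / edist y x) x) ⁻¹' Ioi a =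
      {x | y ∈ U ∧ x ≠ y ∧ dist x y < 1 / ((n : ℝ) + 1)} ∩
        (fun x => edist (f y) (f x) / edist y x) ⁻¹' Ioi a := by
    ext x
    by_cases hx : x ∈ {x | y ∈ U ∧ x ≠ y ∧ dist x y < 1 / ((n : ℝ) + 1)}
    · rw [mem_preimage, indicator_of_mem hx]
      exact ⟨fun h => ⟨hx, h⟩, fun h => h.2⟩
    · rw [mem_preimage, indicator_of_notMem hx]
      exact ⟨fun h => absurd h (by simp), fun h => absurd h.1 hx⟩
  rw [he]
  exact hc.isOpen_inter_preimage hO isOpen_Ioi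

theorem cotangentNorm_smul {k : ℕ} (U : Set X) (φ : X → Euc k) (x : X) (c : ℝ)
    (L : Euc k →L[ℝ] ℝ) :
    cotangentNorm U φ x (c • L) = ENNReal.ofReal |c| * cotangentNorm U φ x L := by
  have h : ∀ y, edist ((c • L) (φ y)) ((c • L) (φ x)) / edist y x
      = ENNReal.ofReal |c| * (edist (L (φ y)) (L (φ x)) / edist y x) := by
    intro y
    rw [← mul_div_assoc]
    congr 1
    simp only [edist_dist, Real.dist_eq, _root_.smul_apply, smul_eq_mul]
    rw [← ENNReal.ofReal_mul (abs_nonneg c), ← abs_mul, mul_sub]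
  simp only [cotangentNorm, lipWithin, h]
  exact ENNReal.limsup_const_mul_of_ne_top ENNReal.ofReal_ne_top

theorem cotangentNorm_le {k : ℕ} (U : Set X) {φ : X → Euc k} {K : NNReal}
    (hφ : LipschitzWith K φ) (x : X) (L L' : Euc k →L[ℝ] ℝ) :
    cotangentNorm U φ x L ≤ cotangentNorm U φ x L' + K * edist L L' := by
  have h : ∀ y, edist (L (φ y)) (L (φ x)) / edist y x
      ≤ edist (L' (φ y)) (L' (φ x)) / edist y x + K * edist L L' := by
    intro y
    have h1 : edist (L (φ y)) (L (φ x))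
        ≤ edist (L' (φ y)) (L' (φ x)) + edist L L' * (K * edist y x) := by
      have e : L (φ y) - L (φ x) = (L' (φ y) - L' (φ x)) + (L - L') (φ y - φ x) := by
        simp only [_root_.sub_apply, map_sub]; ring
      rw [edist_eq_enorm_sub, e, edist_eq_enorm_sub (L' (φ y)), edist_eq_enorm_sub L]
      refine (enorm_add_le _ _).trans (add_le_add le_rfl ?_)
      refine ((L - L').le_opENorm _).trans (mul_le_mul_right ?_ _)
      rw [← edist_eq_enorm_sub]
      exact hφ y x
    refine (ENNReal.div_le_div_right h1 _).trans ?_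
    rw [ENNReal.add_div]
    refine add_le_add le_rfl ?_
    refine ENNReal.div_le_of_le_mul ?_
    rw [← mul_assoc, mul_comm (edist L L')]
  rcases (𝓝[U \ {x}] x).eq_or_neBot with hbot | hne
  · simp [cotangentNorm, lipWithin, hbot]
  · refine (limsup_le_limsup (Eventually.of_forall h)).trans ?_
    rw [limsup_add_const _ _ _ (by isBoundedDefault) (by isBoundedDefault)]
    exact le_rfl

theorem cotangentNorm_ne_top {k : ℕ} (U : Set X) {φ : X → Euc k} {K : NNReal}
    (hφ : LipschitzWith K φ) (x : X) (L : Euc k →L[ℝ] ℝ) : cotangentNorm U φ x L ≠ ∞ := by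
  have h0 : cotangentNorm U φ x 0 = 0 := by
    have := cotangentNorm_smul U φ x 0 0
    simpa using this
  have h := cotangentNorm_le U hφ x L 0
  rw [h0, zero_add] at h
  exact ne_top_of_le_ne_top (ENNReal.mul_ne_top ENNReal.coe_ne_top (edist_ne_top _ _)) h

theorem tangentNorm_add_le {k : ℕ} (U : Set X) (φ : X → Euc k) (x : X) (ξ η : Euc k) :
    tangentNorm U φ x (ξ + η) ≤ tangentNorm U φ x ξ + tangentNorm U φ x η := by
  refine iSup₂_le fun L hL => ?_
  rw [map_add]
  exact ENNReal.ofReal_add_le.trans (add_le_add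
    (le_iSup₂ (f := fun (L : Euc k →L[ℝ] ℝ) (_ : cotangentNorm U φ x L ≤ 1) =>
      ENNReal.ofReal (L ξ)) L hL)
    (le_iSup₂ (f := fun (L : Euc k →L[ℝ] ℝ) (_ : cotangentNorm U φ x L ≤ 1) =>
      ENNReal.ofReal (L η)) L hL))

theorem tangentNorm_smul_le {k : ℕ} (U : Set X) (φ : X → Euc k) (x : X) (c : ℝ) (ξ : Euc k) :
    tangentNorm U φ x (c • ξ) ≤ ENNReal.ofReal |c| * tangentNorm U φ x ξ := by
  refine iSup₂_le fun L hL => ?_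
  rcases le_total 0 c with hc | hc
  · rw [abs_of_nonneg hc, map_smul, smul_eq_mul, ENNReal.ofReal_mul hc]
    exact mul_le_mul_right (le_iSup₂ (f := fun (L : Euc k →L[ℝ] ℝ)
      (_ : cotangentNorm U φ x L ≤ 1) => ENNReal.ofReal (L ξ)) L hL) _
  · have hL' : cotangentNorm U φ x ((-1 : ℝ) • L) ≤ 1 := by
      rw [cotangentNorm_smul]; simpa using hL
    have e : L (c • ξ) = -c * ((-1 : ℝ) • L) ξ := by simp
    rw [abs_of_nonpos hc, e, ENNReal.ofReal_mul (by linarith)]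
    exact mul_le_mul_right (le_iSup₂ (f := fun (L : Euc k →L[ℝ] ℝ)
      (_ : cotangentNorm U φ x L ≤ 1) => ENNReal.ofReal (L ξ)) ((-1 : ℝ) • L) hL') _

theorem tangentNorm_eq_iSup_div {k : ℕ} (U : Set X) {φ : X → Euc k} {K : NNReal}
    (hφ : LipschitzWith K φ) (x : X) (ξ : Euc k) :
    tangentNorm U φ x ξ =
      ⨆ L : Euc k →L[ℝ] ℝ, ENNReal.ofReal (L ξ) / cotangentNorm U φ x L := by
  have hfin := cotangentNorm_ne_top U hφ x
  have hle : ∀ L : Euc k →L[ℝ] ℝ, ENNReal.ofReal (L ξ) / cotangentNorm U φ x L ≤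
      tangentNorm U φ x ξ := by
    intro L
    have hs : ∀ c : NNReal, c * cotangentNorm U φ x L ≤ 1 →
        c * ENNReal.ofReal (L ξ) ≤ tangentNorm U φ x ξ := by
      intro c h
      have h' : cotangentNorm U φ x ((c : ℝ) • L) ≤ 1 := by
        rw [cotangentNorm_smul, abs_of_nonneg c.coe_nonneg, ENNReal.ofReal_coe_nnreal]; exact h
      have := le_iSup₂ (f := fun (L : Euc k →L[ℝ] ℝ)
        (_ : cotangentNorm U φ x L ≤ 1) => ENNReal.ofReal (L ξ)) ((c : ℝ) • L) h'
      simp only [_root_.smul_apply, smul_eq_mul, ENNReal.ofReal_mul c.coe_nonneg,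
        ENNReal.ofReal_coe_nnreal] at this
      exact this
    rw [div_eq_mul_inv, mul_comm]
    rcases eq_or_ne (cotangentNorm U φ x L) 0 with h0 | h0
    · rw [h0, ENNReal.inv_zero, ← ENNReal.iSup_natCast, ENNReal.iSup_mul]
      refine iSup_le fun n => ?_
      have := hs n (by simp [h0])
      simpa using this
    · have hi : (cotangentNorm U φ x L)⁻¹ ≠ ∞ := ENNReal.inv_ne_top.2 h0
      have := hs (cotangentNorm U φ x L)⁻¹.toNNReal (by
        rw [ENNReal.coe_toNNReal hi, ENNReal.inv_mul_cancel h0 (hfin L)])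
      rwa [ENNReal.coe_toNNReal hi] at this
  refine le_antisymm (iSup₂_le fun L hL => ?_) (iSup_le hle)
  refine le_trans ?_ (le_iSup _ L)
  calc ENNReal.ofReal (L ξ) = ENNReal.ofReal (L ξ) / 1 := by rw [div_one]
    _ ≤ _ := ENNReal.div_le_div_left hL _

theorem tangentNorm_eq_iSup_denseSeq {k : ℕ} (U : Set X) {φ : X → Euc k} {K : NNReal}
    (hφ : LipschitzWith K φ) (x : X) (ξ : Euc k) :
    tangentNorm U φ x ξ =
      ⨆ n : ℕ, ENNReal.ofReal (TopologicalSpace.denseSeq (Euc k →L[ℝ] ℝ) n ξ) /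
        cotangentNorm U φ x (TopologicalSpace.denseSeq (Euc k →L[ℝ] ℝ) n) := by
  rw [tangentNorm_eq_iSup_div U hφ]
  have hcont : Continuous (cotangentNorm U φ x) :=
    _root_.continuous_of_le_add_edist K ENNReal.coe_ne_top (cotangentNorm_le U hφ x)
  refine le_antisymm (iSup_le fun L => le_of_forall_lt fun a ha => ?_)
    (iSup_le fun n => le_iSup (fun L : Euc k →L[ℝ] ℝ =>
      ENNReal.ofReal (L ξ) / cotangentNorm U φ x L) _)
  have ha' : a ≠ ∞ := ha.ne_top
  have hiff : ∀ L : Euc k →L[ℝ] ℝ, a < ENNReal.ofReal (L ξ) / cotangentNorm U φ x L ↔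
      a * cotangentNorm U φ x L < ENNReal.ofReal (L ξ) := fun L =>
    ENNReal.lt_div_iff_mul_lt (Or.inr ha') (Or.inl (cotangentNorm_ne_top U hφ x L))
  have hopen : IsOpen {L : Euc k →L[ℝ] ℝ |
      a < ENNReal.ofReal (L ξ) / cotangentNorm U φ x L} := by
    simp only [hiff]
    exact isOpen_lt (ENNReal.continuous_const_mul ha' |>.comp hcont)
      (ENNReal.continuous_ofReal.comp (by fun_prop))
  obtain ⟨n, hL'⟩ :=
    (TopologicalSpace.denseRange_denseSeq (Euc k →L[ℝ] ℝ)).exists_mem_open hopen ⟨L, ha⟩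
  exact lt_of_lt_of_le hL' (le_iSup (fun n : ℕ =>
    ENNReal.ofReal (TopologicalSpace.denseSeq (Euc k →L[ℝ] ℝ) n ξ) /
        cotangentNorm U φ x (TopologicalSpace.denseSeq (Euc k →L[ℝ] ℝ) n)) n)

theorem measurable_tangentNorm [MeasurableSpace X] [BorelSpace X] {k : ℕ} (U : Set X)
    {φ : X → Euc k} {K : NNReal} (hφ : LipschitzWith K φ) {v : X → Euc k} (hv : Measurable v) :
    Measurable fun x => tangentNorm U φ x (v x) := by
  simp only [fun x => tangentNorm_eq_iSup_denseSeq U hφ x (v x)]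
  refine Measurable.iSup fun n => Measurable.div ?_ ?_
  · exact ((ContinuousLinearMap.measurable _).comp hv).ennreal_ofReal
  · exact measurable_lipWithin U ((ContinuousLinearMap.continuous _).comp hφ.continuous)

end Lip
section Bundle

/-- A measurable bundle `⨆ i, dom i × ℝ ^ (dim i)` of Euclidean spaces over the countable
measurable partition `dom` (up to a null set) of `X`, with a norm on each fiber.
The fiber norms take values in `[0, ∞]`, so that the definition makes sense also on
null sets of points where the fiber norm degenerates. -/
structure MeasurableBundle {X : Type*} [MeasurableSpace X] (m : Measure X) where
  ι : Type
  countable_ι : Countable ι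
  dom : ι → Set X
  measurableSet_dom : ∀ i, MeasurableSet (dom i)
  disjoint_dom : Pairwise fun i j => Disjoint (dom i) (dom j)
  measure_compl_dom : m (⋃ i, dom i)ᶜ = 0
  dim : ι → ℕ
  fiberNorm : ∀ i, X → Euc (dim i) → ℝ≥0∞
  fiberNorm_add_le : ∀ i x ξ η,
    fiberNorm i x (ξ + η) ≤ fiberNorm i x ξ + fiberNorm i x η
  fiberNorm_smul_le : ∀ i x (c : ℝ) ξ,
    fiberNorm i x (c • ξ) ≤ ENNReal.ofReal |c| * fiberNorm i x ξ
  measurable_fiberNorm : ∀ i (v : X → Euc (dim i)), Measurable v →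
    Measurable fun x => fiberNorm i x (v x)

namespace MeasurableBundle

variable {X : Type*} [MeasurableSpace X] {m : Measure X} (B : MeasurableBundle m)

/-- Measurable sections of the bundle modulo almost everywhere equality. As the bundle is the
disjoint union of the products `dom i × ℝ ^ (dim i)`, a section is a family of
measurable maps `dom i → ℝ ^ (dim i)`, each considered up to equality `m`-a.e. on `dom i`. -/
abbrev Section : Type _ := ∀ i : B.ι, X →ₘ[m.restrict (B.dom i)] Euc (B.dim i)

variable {B}

/-- The pointwise norm `|v|`; at a point of `dom i` it is the norm of `v x` in the fiber. -/
def ptNorm (v : B.Section) (x : X) : ℝ≥0∞ :=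
  ∑' i, (B.dom i).indicator (fun x => B.fiberNorm i x (v i x)) x

/-- Pointwise multiplication of a section with a function in `L^∞(m)`. -/
def linftySMul (f : Lp ℝ ∞ m) (v : B.Section) : B.Section := fun i =>
  AEEqFun.mk (fun x => f x • v i x)
    ((Lp.aestronglyMeasurable f).restrict.smul (v i).aestronglyMeasurable)

theorem measurable_ptNorm (v : B.Section) : Measurable (ptNorm v) := by
  have := B.countable_ι
  exact Measurable.tsum fun i =>
    (B.measurable_fiberNorm i _ (v i).stronglyMeasurable.measurable).indicator
      (B.measurableSet_dom i)

theorem ptNorm_add_le (v w : B.Section) : ∀ᵐ x ∂m, ptNorm (v + w) x ≤ ptNorm v x + ptNorm w x := by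
  have := B.countable_ι
  have h : ∀ᵐ x ∂m, ∀ i, x ∈ B.dom i → (v + w) i x = v i x + w i x := by
    rw [ae_all_iff]
    intro i
    have := (ae_restrict_iff' (B.measurableSet_dom i)).1 (AEEqFun.coeFn_add (v i) (w i))
    filter_upwards [this] with x hx hi
    exact hx hi
  filter_upwards [h] with x hx
  rw [ptNorm, ptNorm, ptNorm, ← ENNReal.tsum_add]
  refine ENNReal.tsum_le_tsum fun i => ?_
  by_cases hi : x ∈ B.dom i
  · simp only [indicator_of_mem hi, hx i hi]
    exact B.fiberNorm_add_le i x _ _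
  · simp [indicator_of_notMem hi]

theorem ptNorm_smul_le (v w : B.Section) (c : X → ℝ) (C : ℝ) (hc : ∀ᵐ x ∂m, |c x| ≤ C)
    (h : ∀ i, ∀ᵐ x ∂m.restrict (B.dom i), w i x = c x • v i x) :
    ∀ᵐ x ∂m, ptNorm w x ≤ ENNReal.ofReal C * ptNorm v x := by
  have := B.countable_ι
  have h : ∀ᵐ x ∂m, ∀ i, x ∈ B.dom i → w i x = c x • v i x := by
    rw [ae_all_iff]
    exact fun i => (ae_restrict_iff' (B.measurableSet_dom i)).1 (h i)
  filter_upwards [h, hc] with x hx hcx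
  rw [ptNorm, ptNorm, ← ENNReal.tsum_mul_left]
  refine ENNReal.tsum_le_tsum fun i => ?_
  by_cases hi : x ∈ B.dom i
  · simp only [indicator_of_mem hi, hx i hi]
    exact (B.fiberNorm_smul_le i x _ _).trans
      (mul_le_mul_left (ENNReal.ofReal_le_ofReal hcx) _)
  · simp [indicator_of_notMem hi]

theorem lintegral_lt_top_of_smul {v w : B.Section} (C : ℝ)
    (h : ∀ᵐ x ∂m, ptNorm w x ≤ ENNReal.ofReal C * ptNorm v x)
    (hv : ∫⁻ x, ptNorm v x ^ 2 ∂m < ∞) : ∫⁻ x, ptNorm w x ^ 2 ∂m < ∞ := by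
  calc ∫⁻ x, ptNorm w x ^ 2 ∂m
      ≤ ∫⁻ x, ENNReal.ofReal C ^ 2 * ptNorm v x ^ 2 ∂m := by
        refine lintegral_mono_ae ?_
        filter_upwards [h] with x hx
        rw [← mul_pow]
        exact pow_le_pow_left' hx 2
    _ = ENNReal.ofReal C ^ 2 * ∫⁻ x, ptNorm v x ^ 2 ∂m :=
        lintegral_const_mul _ ((measurable_ptNorm v).pow_const 2)
    _ < ∞ := ENNReal.mul_lt_top (by simp) hv

variable (B) in
/-- The space of sections `v` with `∫ |v|² dm < ∞`. -/
def L2 : Submodule ℝ B.Section where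
  carrier := {v | ∫⁻ x, ptNorm v x ^ 2 ∂m < ∞}
  zero_mem' := by
    have h : ∀ᵐ x ∂m, ptNorm (0 : B.Section) x ≤ ENNReal.ofReal 0 * ptNorm (0 : B.Section) x := by
      refine ptNorm_smul_le 0 0 (fun _ => 0) 0 (by simp) fun i => ?_
      filter_upwards [AEEqFun.coeFn_zero (β := Euc (B.dim i)) (μ := m.restrict (B.dom i))]
        with x hx
      simpa using hx
    have h' : ∀ᵐ x ∂m, ptNorm (0 : B.Section) x ^ 2 = 0 := by
      filter_upwards [h] with x hx
      simpa using hx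
    rw [Set.mem_ofPred_eq, lintegral_congr_ae h']
    simp
  add_mem' := by
    intro v w hv hw
    rw [Set.mem_ofPred_eq] at hv hw ⊢
    calc ∫⁻ x, ptNorm (v + w) x ^ 2 ∂m
        ≤ ∫⁻ x, (2 * ptNorm v x ^ 2 + 2 * ptNorm w x ^ 2) ∂m := by
          refine lintegral_mono_ae ?_
          filter_upwards [ptNorm_add_le v w] with x hx
          refine (pow_le_pow_left' hx 2).trans ?_
          have := ENNReal.rpow_add_le_mul_rpow_add_rpow (ptNorm v x) (ptNorm w x)
            (p := 2) (by norm_num)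
          rw [← mul_add]
          have h2 : (2 : ℝ≥0∞) ^ ((2 : ℝ) - 1) = 2 := by norm_num
          rw [h2] at this
          exact_mod_cast this
      _ = 2 * ∫⁻ x, ptNorm v x ^ 2 ∂m + 2 * ∫⁻ x, ptNorm w x ^ 2 ∂m := by
          rw [lintegral_add_left (((measurable_ptNorm v).pow_const 2).const_mul 2),
            lintegral_const_mul _ ((measurable_ptNorm v).pow_const 2),
            lintegral_const_mul _ ((measurable_ptNorm w).pow_const 2)]
      _ < ∞ := ENNReal.add_lt_top.2
          ⟨ENNReal.mul_lt_top (by simp) hv, ENNReal.mul_lt_top (by simp) hw⟩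
  smul_mem' := by
    intro c v hv
    refine lintegral_lt_top_of_smul |c|
      (ptNorm_smul_le v (c • v) (fun _ => c) |c| (by simp) fun i => ?_) hv
    exact AEEqFun.coeFn_smul c (v i)

theorem linftySMul_mem (f : Lp ℝ ∞ m) {v : B.Section} (hv : v ∈ B.L2) :
    linftySMul f v ∈ B.L2 := by
  refine lintegral_lt_top_of_smul ‖f‖
    (ptNorm_smul_le v (linftySMul f v) f ‖f‖ ?_ fun i => ?_) hv
  · filter_upwards [ae_le_eLpNormEssSup (f := f) (μ := m)] with x hx
    rw [← Real.norm_eq_abs, Lp.norm_def, ← toReal_enorm, eLpNorm_exponent_top]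
    refine ENNReal.toReal_mono ?_ hx
    rw [← eLpNorm_exponent_top]
    exact Lp.eLpNorm_ne_top f
  · exact AEEqFun.coeFn_mk _ _

/-- The action of `L^∞(m)` on `B.L2`. -/
instance : SMul (Lp ℝ ∞ m) B.L2 := ⟨fun f v => ⟨linftySMul f v, linftySMul_mem f v.2⟩⟩

end MeasurableBundle

/-- An isometric isomorphism of `L²(m)`-normed `L^∞(m)`-modules: a linear
bijection that commutes with the action of `L^∞(m)` and preserves the pointwise norm. -/
structure NormedModuleIso {X : Type*} [MeasurableSpace X] {m : Measure X}
    (B B' : MeasurableBundle m) where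
  toLinearEquiv : B.L2 ≃ₗ[ℝ] B'.L2
  map_linfty_smul : ∀ (f : Lp ℝ ∞ m) (v : B.L2), toLinearEquiv (f • v) = f • toLinearEquiv v
  ptNorm_map : ∀ v : B.L2,
    MeasurableBundle.ptNorm (toLinearEquiv v : B'.Section) =ᵐ[m]
      MeasurableBundle.ptNorm (v : B.Section)

end Bundle

section MetricMeasure

variable {X : Type*} [MetricSpace X] [MeasurableSpace X] [BorelSpace X] (m : Measure X)

/-- `(U, φ)` is a (weak) chart of dimension `k`: every Lipschitz function `f` is, at `m`-a.e.
`x ∈ U`, differentiable along `U` with respect to `φ`, with a unique differential. -/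
structure IsWeakChart {k : ℕ} (U : Set X) (φ : X → Euc k) : Prop where
  measurableSet : MeasurableSet U
  measure_pos : 0 < m U
  lipschitz : ∃ K, LipschitzWith K φ
  existsUnique_differential : ∀ f : X → ℝ, (∃ K, LipschitzWith K f) →
    ∀ᵐ x ∂m.restrict U, ∃! L : Euc k →L[ℝ] ℝ, lipWithin U (fun y => f y - L (φ y)) x = 0

/-- An atlas: a countable family of weak charts whose domains partition `X` up to a null set. -/
structure Atlas where
  ι : Type
  countable_ι : Countable ι
  dom : ι → Set X
  dim : ι → ℕ
  chart : ∀ i, X → Euc (dim i)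
  isWeakChart : ∀ i, IsWeakChart m (dom i) (chart i)
  disjoint_dom : Pairwise fun i j => Disjoint (dom i) (dom j)
  measure_compl_dom : m (⋃ i, dom i)ᶜ = 0

variable {m} in
/-- The concrete tangent bundle of an atlas. The space `A.tangentBundle.L2` is the
concrete tangent module `Γ₂(TX)`, computed in the atlas `A`. -/
def Atlas.tangentBundle (A : Atlas m) : MeasurableBundle m where
  ι := A.ι
  countable_ι := A.countable_ι
  dom := A.dom
  measurableSet_dom i := (A.isWeakChart i).measurableSet
  disjoint_dom := A.disjoint_dom
  measure_compl_dom := A.measure_compl_dom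
  dim := A.dim
  fiberNorm i x ξ := tangentNorm (A.dom i) (A.chart i) x ξ
  fiberNorm_add_le _ x ξ η := tangentNorm_add_le _ _ x ξ η
  fiberNorm_smul_le _ x c ξ := tangentNorm_smul_le _ _ x c ξ
  measurable_fiberNorm i _ hv :=
    measurable_tangentNorm _ (A.isWeakChart i).lipschitz.choose_spec hv

/-- `φ` restricted to `U` is `K`-bi-Lipschitz onto its image. -/
def IsBiLipschitzOn {k : ℕ} (K : ℝ) (U : Set X) (φ : X → Euc k) : Prop :=
  ∀ x ∈ U, ∀ y ∈ U, dist x y / K ≤ dist (φ x) (φ y) ∧ dist (φ x) (φ y) ≤ K * dist x y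

/-- `(U, φ)` is a rectifiable chart of dimension `k`; only the values of `φ` on `U` matter. -/
structure IsRectifiableChart {k : ℕ} (U : Set X) (φ : X → Euc k) : Prop where
  measurableSet : MeasurableSet U
  biLipschitz : ∃ K : ℝ, 1 ≤ K ∧ IsBiLipschitzOn K U φ
  absolutelyContinuous : m.restrict U ≪ (Measure.hausdorffMeasure (k : ℝ)).restrict U

/-- For every `ε > 0`, `X` is covered up to a null set by countably many `(1 + ε)`-bi-Lipschitz
rectifiable charts, of arbitrary dimensions. -/
def StronglyRectifiable : Prop :=
  ∀ ε : ℝ, 0 < ε → ∃ (dim : ℕ → ℕ) (U : ℕ → Set X) (φ : ∀ j, X → Euc (dim j)),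
    (∀ j, IsRectifiableChart m (U j) (φ j) ∧ IsBiLipschitzOn (1 + ε) (U j) (φ j)) ∧
    m (⋃ j, U j)ᶜ = 0

/-- `m` restricted to `A` is `k`-rectifiable: `A` is covered up to a null set by countably many
`k`-dimensional rectifiable charts. -/
def IsRectifiableSet (k : ℕ) (A : Set X) : Prop :=
  ∃ (U : ℕ → Set X) (φ : ℕ → X → Euc k),
    (∀ j, IsRectifiableChart m (U j) (φ j)) ∧ m (A \ ⋃ j, U j) = 0

/-- A partition, up to a null set, of `X` into Borel sets `A k`, the `k`-th being
`k`-rectifiable (the dimensional decomposition of `X`). -/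
structure DimensionalDecomposition where
  part : ℕ → Set X
  measurableSet_part : ∀ k, MeasurableSet (part k)
  disjoint_part : Pairwise fun k l => Disjoint (part k) (part l)
  measure_compl_part : m (⋃ k, part k)ᶜ = 0
  rectifiable : ∀ k, IsRectifiableSet m k (part k)

variable {m} in
/-- The Gromov–Hausdorff tangent bundle `⨆ k, A k × ℝ ^ k` with Euclidean norms on the fibers.
The space `D.tangentBundleGH.L2` is the Gromov–Hausdorff tangent module. -/
def DimensionalDecomposition.tangentBundleGH (D : DimensionalDecomposition m) :
    MeasurableBundle m where
  ι := ℕ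
  countable_ι := inferInstance
  dom := D.part
  measurableSet_dom := D.measurableSet_part
  disjoint_dom := D.disjoint_part
  measure_compl_dom := D.measure_compl_part
  dim k := k
  fiberNorm _ _ ξ := ‖ξ‖ₑ
  fiberNorm_add_le _ _ ξ η := enorm_add_le ξ η
  fiberNorm_smul_le _ _ c ξ := by rw [enorm_smul, ← Real.norm_eq_abs, ofReal_norm]
  measurable_fiberNorm _ _ hv := hv.enorm

end MetricMeasure

end ConcreteTangent

end

/-! Fix a weak chart `(U, φ)` and a `K`-bi-Lipschitz rectifiable chart `(W, θ)`, and put `V = U ∩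
W`. Rademacher's theorem for `φ ∘ θ⁻¹` on `θ '' V` gives, at almost every point of `V`, a linear `R`
with `φ = R ∘ θ` to first order along `V`. Since almost every point of `θ '' V` is a density point,
`‖M‖` and `lip (M ∘ θ|_V)` agree up to the factor `K`. Hence, once Lipschitz constants along `U` and
along `V` are known to agree, the covector norm `L ↦ lip (L ∘ φ|_U)` equals `‖L ∘ R‖` up to the
factor `K`, and the chart property forces `R` to be invertible, so the dimensions agree
(`IsWeakChart.ae_cotangentNorm`).

As `m` need not be doubling, the passage from `U` to `V` cannot rest on a density theorem for `m`.
It rests on `ae_lipWithin_infDist_eq_zero`: if the distance to `V` had a positive Lipschitz constant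
along `U` on a non-null subset of `V`, then `k + 1` Lipschitz functions of this distance, living on
disjoint families of scales, would be independent to first order at some point, although their
differentials lie in a `k`-dimensional dual.

Letting `K → 1` along the strongly rectifiable decompositions, compactness of the maps `R` turns the
approximate identities into an exact one: almost every fiber of the concrete tangent bundle is
Euclidean (`StronglyRectifiable.ae_exists_tangentNorm_eq`). Measurable Gram–Schmidt makes the
fiberwise isometries measurable, and these induce the isomorphism of modules. An atlas exists
because Lipschitz extensions of rectifiable charts are weak charts, by the same Rademacher and
density arguments. -/

noncomputable section

namespace ConcreteTangent

/-! ### Calculus of the pointwise Lipschitz constant. -/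

section LipCalculus

variable {X : Type*} [MetricSpace X] {U V : Set X} {f g : X → ℝ} {x : X} {C : ℝ}

theorem edist_div_edist_le_iff {y : X} (hxy : y ≠ x) (hC : 0 ≤ C) :
    edist (f y) (f x) / edist y x ≤ ENNReal.ofReal C ↔ |f y - f x| ≤ C * dist y x := by
  rw [ENNReal.div_le_iff (by simpa using hxy) (edist_ne_top _ _), edist_dist, edist_dist,
    ← ENNReal.ofReal_mul hC, ENNReal.ofReal_le_ofReal_iff (by positivity), Real.dist_eq]

theorem le_edist_div_edist_iff {y : X} (hxy : y ≠ x) (hC : 0 ≤ C) :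
    ENNReal.ofReal C ≤ edist (f y) (f x) / edist y x ↔ C * dist y x ≤ |f y - f x| := by
  rw [ENNReal.le_div_iff_mul_le (Or.inl (by simpa using hxy)) (Or.inl (edist_ne_top _ _)),
    edist_dist, edist_dist, ← ENNReal.ofReal_mul hC, ENNReal.ofReal_le_ofReal_iff (by positivity),
    Real.dist_eq]

theorem eventually_ne_nhdsWithin_diff : ∀ᶠ y in 𝓝[U \ {x}] x, y ≠ x := by
  filter_upwards [self_mem_nhdsWithin] with y hy using hy.2

theorem lipWithin_le_of_eventually (hC : 0 ≤ C)
    (h : ∀ᶠ y in 𝓝[U \ {x}] x, |f y - f x| ≤ C * dist y x) :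
    lipWithin U f x ≤ ENNReal.ofReal C := by
  refine limsup_le_of_le (by isBoundedDefault) ?_
  filter_upwards [h, eventually_ne_nhdsWithin_diff] with y hy hne
  exact (edist_div_edist_le_iff hne hC).2 hy

theorem eventually_le_of_lipWithin_lt (hC : 0 ≤ C) (h : lipWithin U f x < ENNReal.ofReal C) :
    ∀ᶠ y in 𝓝[U \ {x}] x, |f y - f x| ≤ C * dist y x := by
  have h' := eventually_lt_of_limsup_lt h (by isBoundedDefault)
  filter_upwards [h', eventually_ne_nhdsWithin_diff] with y hy hne
  exact (edist_div_edist_le_iff hne hC).1 hy.le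

theorem le_lipWithin_of_frequently (hC : 0 ≤ C)
    (h : ∃ᶠ y in 𝓝[U \ {x}] x, C * dist y x ≤ |f y - f x|) :
    ENNReal.ofReal C ≤ lipWithin U f x := by
  refine le_limsup_of_frequently_le ?_ (by isBoundedDefault)
  refine (h.and_eventually eventually_ne_nhdsWithin_diff).mono fun y hy => ?_
  exact (le_edist_div_edist_iff hy.2 hC).2 hy.1

theorem lipWithin_eq_zero_iff :
    lipWithin U f x = 0 ↔ ∀ ε > 0, ∀ᶠ y in 𝓝[U \ {x}] x, |f y - f x| ≤ ε * dist y x := by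
  constructor
  · intro h ε hε
    refine eventually_le_of_lipWithin_lt hε.le ?_
    rw [h]
    exact ENNReal.ofReal_pos.2 hε
  · intro h
    refine le_antisymm (ENNReal.le_of_forall_pos_le_add fun ε hε _ => ?_) (zero_le)
    have := lipWithin_le_of_eventually (NNReal.coe_nonneg ε) (h ε hε)
    simpa using this

theorem lipWithin_add_le : lipWithin U (fun y => f y + g y) x ≤ lipWithin U f x + lipWithin U g x := by
  refine ENNReal.le_of_forall_pos_le_add fun ε hε hfin => ?_
  obtain ⟨hf, hg⟩ := ENNReal.add_lt_top.1 hfin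
  have hε2 : (ε : ℝ≥0∞) / 2 ≠ 0 := by simpa using hε.ne'
  have h1 := eventually_lt_of_limsup_lt (ENNReal.lt_add_right hf.ne hε2) (by isBoundedDefault)
  have h2 := eventually_lt_of_limsup_lt (ENNReal.lt_add_right hg.ne hε2) (by isBoundedDefault)
  refine limsup_le_of_le (by isBoundedDefault) ?_
  filter_upwards [h1, h2] with y hy1 hy2
  calc edist (f y + g y) (f x + g x) / edist y x
      ≤ edist (f y) (f x) / edist y x + edist (g y) (g x) / edist y x := by
        rw [← ENNReal.add_div]
        exact ENNReal.div_le_div_right (edist_add_add_le _ _ _ _) _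
    _ ≤ (lipWithin U f x + ε / 2) + (lipWithin U g x + ε / 2) := add_le_add hy1.le hy2.le
    _ = lipWithin U f x + lipWithin U g x + ε := by
        rw [add_add_add_comm, ENNReal.add_halves]

theorem lipWithin_const_mul (c : ℝ) :
    lipWithin U (fun y => c * f y) x = ENNReal.ofReal |c| * lipWithin U f x := by
  have h : ∀ y, edist (c * f y) (c * f x) / edist y x
      = ENNReal.ofReal |c| * (edist (f y) (f x) / edist y x) := by
    intro y
    rw [← mul_div_assoc]
    congr 1
    simp only [edist_dist, Real.dist_eq]
    rw [← ENNReal.ofReal_mul (abs_nonneg c), ← abs_mul, mul_sub]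
  simp only [lipWithin, h]
  exact ENNReal.limsup_const_mul_of_ne_top ENNReal.ofReal_ne_top

theorem lipWithin_neg : lipWithin U (fun y => - f y) x = lipWithin U f x := by
  simpa using lipWithin_const_mul (U := U) (f := f) (x := x) (-1)

theorem lipWithin_zero : lipWithin U (fun _ => (0 : ℝ)) x = 0 := by
  simpa using lipWithin_const_mul (U := U) (f := fun _ => (0 : ℝ)) (x := x) 0

theorem lipWithin_sum_eq_zero {ι : Type*} (s : Finset ι) {F : ι → X → ℝ}
    (h : ∀ i ∈ s, lipWithin U (F i) x = 0) : lipWithin U (fun y => ∑ i ∈ s, F i y) x = 0 := by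
  classical
  induction s using Finset.induction_on with
  | empty => simpa using lipWithin_zero
  | insert a s ha ih =>
    simp only [Finset.sum_insert ha]
    refine le_antisymm (lipWithin_add_le.trans ?_) (zero_le)
    rw [h a (Finset.mem_insert_self a s), ih fun i hi => h i (Finset.mem_insert_of_mem hi), add_zero]

theorem lipWithin_congr_of_sub_eq_zero (h : lipWithin U (fun y => f y - g y) x = 0) :
    lipWithin U f x = lipWithin U g x := by
  apply le_antisymm
  · have := lipWithin_add_le (U := U) (f := fun y => f y - g y) (g := g) (x := x)
    simpa [h] using this
  · have := lipWithin_add_le (U := U) (f := fun y => -(f y - g y)) (g := f) (x := x)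
    rw [lipWithin_neg, h] at this
    simpa using this

theorem lipWithin_mono (h : V ⊆ U) : lipWithin V f x ≤ lipWithin U f x :=
  limsup_le_limsup_of_le (nhdsWithin_mono _ (sdiff_subset_sdiff_left h))

theorem lipWithin_eq_zero_of_subset (h : V ⊆ U) (h0 : lipWithin U f x = 0) :
    lipWithin V f x = 0 :=
  le_antisymm ((lipWithin_mono h).trans h0.le) (zero_le)

theorem lipWithin_congr_on (h : EqOn f g U) (hx : x ∈ U) : lipWithin U f x = lipWithin U g x := by
  refine limsup_congr ?_
  filter_upwards [self_mem_nhdsWithin] with y hy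
  rw [h hy.1, h hx]

theorem lipWithin_le_of_lipschitzWith {K : NNReal} (hf : LipschitzWith K f) :
    lipWithin U f x ≤ K := by
  refine limsup_le_of_le (by isBoundedDefault) (Eventually.of_forall fun y => ?_)
  exact ENNReal.div_le_of_le_mul (hf y x)

/-- If `V` is so thick in `U` at `x` that the distance to `V` is differentiable along `U` at `x`
with zero differential, then the Lipschitz constants along `U` and along `V` agree. -/
theorem lipWithin_eq_of_infDist {K : NNReal} (hf : LipschitzWith K f) (hVU : V ⊆ U) (hx : x ∈ V)
    (h : lipWithin U (fun y => Metric.infDist y V) x = 0) : lipWithin U f x = lipWithin V f x := by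
  refine le_antisymm ?_ (lipWithin_mono hVU)
  have hfin : lipWithin V f x ≠ ∞ :=
    ne_top_of_le_ne_top ENNReal.coe_ne_top (lipWithin_le_of_lipschitzWith hf)
  refine ENNReal.le_of_forall_pos_le_add fun ε hε _ => ?_
  set c : ℝ := (lipWithin V f x).toReal with hc
  have hc0 : 0 ≤ c := ENNReal.toReal_nonneg
  have hε' : (0 : ℝ) < ε := hε
  have hK : (0 : ℝ) ≤ K := K.2
  -- With `d = dist y x`, replacing `y` by a point `z` of `V` at distance below `η d` costs `K η d`
  -- and puts `z` within `(1 + η) d` of `x`. The total excess `η (K + c + ε / 2) d` has to stay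
  -- below `ε / 2 * d`.
  set η : ℝ := min 1 (ε / (2 * (K + c + ε + 1))) with hη
  have hη0 : 0 < η := lt_min one_pos (by positivity)
  have hη1 : η ≤ 1 := min_le_left _ _
  have hη2 : η * (K + c + ε) ≤ ε / 2 := by
    have h1 : η ≤ ε / (2 * (K + c + ε + 1)) := min_le_right _ _
    rw [le_div_iff₀ (by positivity)] at h1
    nlinarith
  have hlt : lipWithin V f x < ENNReal.ofReal (c + ε / 2) := by
    rw [ENNReal.lt_ofReal_iff_toReal_lt hfin]
    linarith
  have h1 := eventually_le_of_lipWithin_lt (by positivity) hlt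
  rw [eventually_nhdsWithin_iff, Metric.eventually_nhds_iff] at h1
  obtain ⟨r, hr, h1⟩ := h1
  have h2 := lipWithin_eq_zero_iff.1 h (η / 2) (by positivity)
  -- As `η ≤ 1`, the substitute `z` is at most twice as far from `x` as `y`, hence within `r`.
  have h3 : ∀ᶠ y in 𝓝[U \ {x}] x, dist y x < r / 2 :=
    mem_nhdsWithin_of_mem_nhds (Metric.ball_mem_nhds x (by positivity))
  have : lipWithin U f x ≤ ENNReal.ofReal (c + ε) := by
    refine lipWithin_le_of_eventually (by positivity) ?_
    filter_upwards [h2, h3, eventually_ne_nhdsWithin_diff] with y hy hyr hne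
    have hd : 0 < dist y x := dist_pos.2 hne
    rw [Metric.infDist_zero_of_mem hx, sub_zero, abs_of_nonneg Metric.infDist_nonneg] at hy
    obtain ⟨z, hz, hyz⟩ := (Metric.infDist_lt_iff ⟨x, hx⟩).1
      (lt_of_le_of_lt hy (show η / 2 * dist y x < η * dist y x by nlinarith))
    have hzx : dist z x ≤ (1 + η) * dist y x := by
      have := dist_triangle_left z x y
      nlinarith
    have hfz : |f z - f x| ≤ (c + ε / 2) * dist z x := by
      by_cases hzx' : z = x
      · simp [hzx']
      · exact h1 (by nlinarith) ⟨hz, hzx'⟩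
    have hfy : |f y - f z| ≤ K * dist y z := by
      have := hf.dist_le_mul y z
      rwa [Real.dist_eq] at this
    have h4 : |f y - f x| ≤ |f y - f z| + |f z - f x| := abs_sub_le _ _ _
    have h5 : (c + ε / 2) * dist z x ≤ (c + ε / 2) * ((1 + η) * dist y x) :=
      mul_le_mul_of_nonneg_left hzx (by positivity)
    have h6 : K * dist y z ≤ K * (η * dist y x) := mul_le_mul_of_nonneg_left hyz.le hK
    have h7 : (η * (K + c + ε)) * dist y x ≤ ε / 2 * dist y x :=
      mul_le_mul_of_nonneg_right hη2 hd.le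
    have h8 : 0 ≤ η * ε * dist y x := by positivity
    nlinarith
  refine this.trans ?_
  rw [ENNReal.ofReal_add hc0 hε'.le, hc, ENNReal.ofReal_toReal hfin, ENNReal.ofReal_coe_nnreal]

end LipCalculus

/-! ### Weak charts exclude porosity: thickness of subsets without a density theorem. -/

section Porosity

variable {X : Type*} [MetricSpace X]

/-- The `1`-Lipschitz function of `t` given by the distance to the complement of the intervals
`(r (n + 1) / 2, 2 r n)`, where `n` runs through the residue class of `2 j` modulo `2 (k + 1)`. -/
def bandFun (r : ℕ → ℝ) (k j : ℕ) (t : ℝ) : ℝ :=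
  Metric.infDist t {s | ∀ n, n % (2 * (k + 1)) = 2 * j → s ∉ Ioo (r (n + 1) / 2) (2 * r n)}

theorem lipschitzWith_bandFun (r : ℕ → ℝ) (k j : ℕ) : LipschitzWith 1 (bandFun r k j) :=
  Metric.lipschitz_infDist_pt _

theorem bandFun_zero {r : ℕ → ℝ} (hr : ∀ n, 0 < r n) (k j : ℕ) : bandFun r k j 0 = 0 := by
  refine Metric.infDist_zero_of_mem fun n _ h => ?_
  have := h.1
  have := hr (n + 1)
  linarith

/-- A point `t` of `[r (n + 1), r n)` lies at least `t / 2` above `r (n + 1) / 2` and at least `t`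
below `2 r n`. -/
theorem half_le_bandFun {r : ℕ → ℝ} (hr : ∀ n, 0 < r n) {k j n : ℕ}
    (hn : n % (2 * (k + 1)) = 2 * j) {t : ℝ} (h1 : r (n + 1) ≤ t) (h2 : t < r n) :
    t / 2 ≤ bandFun r k j t := by
  refine (Metric.le_infDist ⟨0, fun n _ h => ?_⟩).2 fun {s} hs => ?_
  · have := h.1
    have := hr (n + 1)
    linarith
  · have := hs n hn
    rw [mem_Ioo, not_and_or, not_lt, not_lt] at this
    rw [Real.dist_eq]
    have ht : 0 < t := (hr _).trans_le h1
    rcases this with h | h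
    · exact le_trans (by linarith) (le_abs_self _)
    · exact le_trans (by linarith) (neg_le_abs _)

/-- Only even indices carry intervals. Two distinct ones differ by at least 2, so the decay by a
factor 4 leaves room for the factors 2 by which the intervals are enlarged. -/
theorem bandFun_eq_zero {r : ℕ → ℝ} (hr : ∀ n, 0 < r n) (hr4 : ∀ n, r (n + 1) ≤ r n / 4)
    {k j j' n : ℕ} (hn : n % (2 * (k + 1)) = 2 * j) (hj : j' ≠ j) {t : ℝ} (h1 : r (n + 1) ≤ t)
    (h2 : t < r n) : bandFun r k j' t = 0 := by
  have hanti : Antitone r := antitone_nat_of_succ_le fun n => by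
    have := hr4 n
    have := hr n
    linarith
  refine Metric.infDist_zero_of_mem fun n' hn' h => ?_
  have hne : n' ≠ n := by
    rintro rfl
    omega
  have e1 : n % 2 = 0 := by
    rw [← Nat.mod_mod_of_dvd n (Dvd.intro (k + 1) rfl), hn]
    omega
  have e2 : n' % 2 = 0 := by
    rw [← Nat.mod_mod_of_dvd n' (Dvd.intro (k + 1) rfl), hn']
    omega
  rcases lt_or_gt_of_ne hne with hlt | hlt
  · have h3 : r n ≤ r (n' + 2) := hanti (by omega)
    have h4 := hr4 (n' + 1)
    have := hr (n' + 1)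
    have := h.1
    linarith
  · have h3 : r n' ≤ r (n + 2) := hanti (by omega)
    have h4 := hr4 (n + 1)
    have := hr (n + 1)
    have := h.2
    linarith

/-- The points that see, at distance comparable to its distance `d` to `V`, a point of `U` with
`r ≤ d < R`. -/
def seesBand (U V : Set X) (a r R : ℝ) : Set X :=
  {x | ∃ y ∈ U, r ≤ Metric.infDist y V ∧ Metric.infDist y V < R ∧
    dist y x < a * Metric.infDist y V}

/-- Openness gives measurability although `U` and `V` are arbitrary sets. -/
theorem isOpen_seesBand (U V : Set X) (a r R : ℝ) : IsOpen (seesBand U V a r R) := by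
  have : seesBand U V a r R = ⋃ y ∈ {y | y ∈ U ∧ r ≤ Metric.infDist y V ∧ Metric.infDist y V < R},
      Metric.ball y (a * Metric.infDist y V) := by
    ext x
    simp only [seesBand, Set.mem_ofPred_eq, mem_iUnion, Metric.mem_ball, exists_prop, dist_comm x,
      and_assoc]
  rw [this]
  exact isOpen_biUnion fun y _ => Metric.isOpen_ball

theorem seesBand_anti (U V : Set X) (a R : ℝ) {r r' : ℝ} (h : r ≤ r') :
    seesBand U V a r' R ⊆ seesBand U V a r R :=
  fun _ ⟨y, hy, h1, h2⟩ => ⟨y, hy, h.trans h1, h2⟩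

/-- For `x` in the closure of `V` the distance of `y` to `V` is at most `dist y x`, so points `y`
near `x` that witness the large Lipschitz constant lie below any level `R`. Their distance to `V` is
positive, which provides the lower level. -/
theorem exists_mem_seesBand {U V : Set X} {a : ℝ} (ha : 0 < a) {x : X} (hx : x ∈ closure V)
    (h : ENNReal.ofReal (1 / a) < lipWithin U (fun y => Metric.infDist y V) x) {R : ℝ}
    (hR : 0 < R) : ∃ n : ℕ, x ∈ seesBand U V a (1 / (n + 1)) R := by
  have hV : V.Nonempty := closure_nonempty_iff.1 ⟨x, hx⟩
  have hx0 : Metric.infDist x V = 0 := (Metric.mem_closure_iff_infDist_zero hV).1 hx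
  have h1 := frequently_lt_of_lt_limsup (by isBoundedDefault) h
  have h3 : ∀ᶠ y in 𝓝[U \ {x}] x, dist y x < R :=
    mem_nhdsWithin_of_mem_nhds (Metric.ball_mem_nhds x hR)
  obtain ⟨y, ⟨hy1, hy2⟩, hy3⟩ := ((h1.and_eventually h3).and_eventually self_mem_nhdsWithin).exists
  have h4 : dist y x < a * Metric.infDist y V := by
    have := mt (edist_div_edist_le_iff (f := fun y => Metric.infDist y V) hy3.2
      (by positivity : 0 ≤ 1 / a)).2 (not_le.2 hy1)
    rw [hx0, sub_zero, abs_of_nonneg Metric.infDist_nonneg, not_le] at this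
    calc dist y x = a * (1 / a * dist y x) := by field_simp
      _ < _ := mul_lt_mul_of_pos_left this ha
  have h5 : 0 < Metric.infDist y V := by
    have := dist_nonneg.trans_lt h4
    exact pos_of_mul_pos_right this ha.le
  obtain ⟨n, hn⟩ := exists_nat_one_div_lt h5
  refine ⟨n, y, hy3.1, hn.le, ?_, h4⟩
  have := Metric.infDist_le_infDist_add_dist (s := V) (x := y) (y := x)
  linarith

variable [MeasurableSpace X] [BorelSpace X]

/-- If every Lipschitz function is a.e. differentiable along `U` with respect to the finite
dimensional `φ`, then `U` is not thicker than `V` at almost every point of `V`. -/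
theorem ae_lipWithin_infDist_eq_zero {k : ℕ} (ν : Measure X) [IsFiniteMeasure ν] (U V : Set X)
    (φ : X → Euc k)
    (hdiff : ∀ f : X → ℝ, (∃ K, LipschitzWith K f) →
      ∀ᵐ x ∂ν, ∃ L : Euc k →L[ℝ] ℝ, lipWithin U (fun y => f y - L (φ y)) x = 0) :
    ∀ᵐ x ∂ν, x ∈ V → lipWithin U (fun y => Metric.infDist y V) x = 0 := by
  -- Working on `closure V` makes the exceptional set `P` measurable for arbitrary `V`.
  have key : ∀ a : ℝ, 0 < a → ∀ᵐ x ∂ν, x ∈ closure V →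
      lipWithin U (fun y => Metric.infDist y V) x ≤ ENNReal.ofReal (1 / a) := by
    intro a ha
    set P : Set X := {x | x ∈ closure V ∧
      ENNReal.ofReal (1 / a) < lipWithin U (fun y => Metric.infDist y V) x} with hP
    have hPm : MeasurableSet P := isClosed_closure.measurableSet.inter
      (measurableSet_lt measurable_const
        (measurable_lipWithin U (Metric.continuous_infDist_pt V)))
    -- Given the upper end of a band, its lower end can be taken so small that all of `P` except
    -- measure `2⁻ⁿ` sees the band: the sets missed decrease to the empty set and `ν` is finite.
    have step : ∀ (n : ℕ) (R : {R : ℝ // 0 < R}), ∃ r : {R : ℝ // 0 < R}, r.1 ≤ R.1 / 4 ∧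
        ν (P \ seesBand U V a r R) ≤ (2⁻¹ : ℝ≥0∞) ^ n := by
      rintro n ⟨R, hR⟩
      have hlim : Tendsto (fun i : ℕ => ν (P \ seesBand U V a (1 / (i + 1)) R)) atTop
          (𝓝 (ν (⋂ i : ℕ, P \ seesBand U V a (1 / (i + 1)) R))) := by
        refine tendsto_measure_iInter_atTop
          (fun i => (hPm.diff (isOpen_seesBand _ _ _ _ _).measurableSet).nullMeasurableSet)
          ?_ ⟨0, measure_ne_top _ _⟩
        intro i j hij
        refine sdiff_subset_sdiff_right (seesBand_anti _ _ _ _ ?_)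
        exact Nat.one_div_le_one_div hij
      have hempty : ⋂ i : ℕ, P \ seesBand U V a (1 / (i + 1)) R = ∅ := by
        refine eq_empty_of_forall_notMem fun x hx => ?_
        have hx' := mem_iInter.1 hx
        obtain ⟨i, hi⟩ := exists_mem_seesBand ha (hx' 0).1.1 (hx' 0).1.2 hR
        exact (hx' i).2 hi
      rw [hempty, measure_empty] at hlim
      have hpos : (0 : ℝ≥0∞) < 2⁻¹ ^ n := ENNReal.pow_pos (by simp) n
      have hsmall : ∀ᶠ i : ℕ in atTop, 1 / ((i : ℝ) + 1) < R / 4 :=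
        tendsto_one_div_add_atTop_nhds_zero_nat.eventually_lt_const (by positivity)
      obtain ⟨i, hi, hi'⟩ := ((hlim.eventually_lt_const hpos).and hsmall).exists
      exact ⟨⟨1 / ((i : ℝ) + 1), by positivity⟩, hi'.le, hi.le⟩
    choose next hnext4 hnext using step
    let rs : ℕ → {R : ℝ // 0 < R} := fun n => Nat.rec ⟨1, one_pos⟩ next n
    let r : ℕ → ℝ := fun n => (rs n).1
    have hr : ∀ n, 0 < r n := fun n => (rs n).2
    have hr4 : ∀ n, r (n + 1) ≤ r n / 4 := fun n => hnext4 n (rs n)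
    have hrlim : Tendsto r atTop (𝓝 0) := by
      have hle : ∀ n, r n ≤ (1 / 4 : ℝ) ^ n := by
        intro n
        induction n with
        | zero => exact le_rfl
        | succ n ih =>
          rw [pow_succ]
          have := hr4 n
          linarith
      exact squeeze_zero (fun n => (hr n).le) hle
        (tendsto_pow_atTop_nhds_zero_of_lt_one (by norm_num) (by norm_num))
    -- Borel–Cantelli: almost every point of `P` sees all bands from some index on.
    have hBC : ∀ᵐ x ∂ν, ∀ᶠ n in atTop, x ∉ P \ seesBand U V a (r (n + 1)) (r n) := by
      refine ae_eventually_notMem (ne_top_of_le_ne_top ?_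
        (ENNReal.tsum_le_tsum fun n => hnext n (rs n)))
      rw [ENNReal.tsum_geometric]
      simp
    -- One function more than the dimension of the dual, so that the differentials are linearly
    -- dependent.
    have hD : ∀ᵐ x ∂ν, ∀ j : Fin (k + 1), ∃ L : Euc k →L[ℝ] ℝ,
        lipWithin U (fun y => bandFun r k j (Metric.infDist y V) - L (φ y)) x = 0 := by
      rw [ae_all_iff]
      exact fun j => hdiff _ ⟨1 * 1, (lipschitzWith_bandFun r k j).comp (Metric.lipschitz_infDist_pt V)⟩
    filter_upwards [hBC, hD] with x hx hL hxV
    by_contra hlt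
    rw [not_le] at hlt
    have hxP : x ∈ P := ⟨hxV, hlt⟩
    have hV : V.Nonempty := closure_nonempty_iff.1 ⟨x, hxV⟩
    have hx0 : Metric.infDist x V = 0 := (Metric.mem_closure_iff_infDist_zero hV).1 hxV
    choose L hL using hL
    have hdep : ¬ LinearIndependent ℝ L := by
      intro hli
      have h1 := hli.fintype_card_le_finrank
      have h2 : Module.finrank ℝ (Euc k →L[ℝ] ℝ) = k := by
        rw [← (LinearMap.toContinuousLinearMap (𝕜 := ℝ) (E := Euc k) (F' := ℝ)).finrank_eq]
        simp
      rw [h2, Fintype.card_fin] at h1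
      omega
    obtain ⟨c, hc, j₀, hj₀⟩ := Fintype.not_linearIndependent_iff.1 hdep
    have hsum : lipWithin U (fun y => ∑ j, c j * bandFun r k j (Metric.infDist y V)) x = 0 := by
      have h1 : lipWithin U (fun y => ∑ j,
          c j * (bandFun r k j (Metric.infDist y V) - L j (φ y))) x = 0 := by
        refine lipWithin_sum_eq_zero _ fun j _ => ?_
        rw [lipWithin_const_mul, hL, mul_zero]
      rw [← h1]
      congr 1
      funext y
      have h2 : ∑ j, c j * L j (φ y) = 0 := by
        have := congrArg (fun M : Euc k →L[ℝ] ℝ => M (φ y)) hc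
        simpa [_root_.sum_apply] using this
      simp only [mul_sub, Finset.sum_sub_distrib, h2, sub_zero]
    have hc0 : 0 < |c j₀| := abs_pos.2 hj₀
    -- At a point `y` seen in a band of class `2 * j₀`, with `D` its distance to `V`, the
    -- combination is at least `|c j₀| * D / 2`. As `dist y x < a * D`, the constant `|c j₀| / (4 *
    -- a)` bounds it by `|c j₀| * D / 4`, a contradiction.
    have hev := lipWithin_eq_zero_iff.1 hsum (|c j₀| / (4 * a)) (by positivity)
    rw [eventually_nhdsWithin_iff, Metric.eventually_nhds_iff] at hev
    obtain ⟨δ, hδ, hev⟩ := hev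
    have hfreq : ∃ᶠ n in atTop, n % (2 * (k + 1)) = 2 * (j₀ : ℕ) := by
      rw [Nat.frequently_atTop_iff_infinite]
      refine Set.infinite_of_not_bddAbove ?_
      rintro ⟨M, hM⟩
      have hj := j₀.2
      have : 2 * (k + 1) * (M + 1) + 2 * (j₀ : ℕ) ≤ M := hM (by
        rw [Set.mem_ofPred_eq, Nat.mul_add_mod]
        exact Nat.mod_eq_of_lt (by omega))
      nlinarith
    have hrsmall : ∀ᶠ n in atTop, r n < δ / a := hrlim.eventually_lt_const (by positivity)
    obtain ⟨n, ⟨hn, hn1⟩, hn2⟩ := ((hfreq.and_eventually hx).and_eventually hrsmall).exists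
    have hmem : x ∈ seesBand U V a (r (n + 1)) (r n) := by
      by_contra hcon
      exact hn1 ⟨hxP, hcon⟩
    obtain ⟨y, hyU, hy1, hy2, hy3⟩ := hmem
    have hd0 : 0 < Metric.infDist y V := (hr (n + 1)).trans_le hy1
    have hyx : y ≠ x := by
      rintro rfl
      exact hd0.ne' hx0
    have hdδ : dist y x < δ := by
      calc dist y x < a * Metric.infDist y V := hy3
        _ ≤ a * (δ / a) := mul_le_mul_of_nonneg_left (hy2.le.trans hn2.le) ha.le
        _ = δ := by field_simp
    have h1 := hev hdδ ⟨hyU, hyx⟩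
    have h2 : ∑ j, c j * bandFun r k j (Metric.infDist y V) =
        c j₀ * bandFun r k j₀ (Metric.infDist y V) := by
      refine Finset.sum_eq_single j₀ (fun j _ hj => ?_) (by simp)
      rw [bandFun_eq_zero hr hr4 hn (fun h => hj (Fin.ext h)) hy1 hy2, mul_zero]
    have h3 : ∑ j, c j * bandFun r k j (Metric.infDist x V) = 0 := by
      simp [hx0, bandFun_zero hr]
    have h4 := half_le_bandFun hr hn hy1 hy2
    rw [h2, h3, sub_zero, abs_mul] at h1
    have h5 : |c j₀| * (Metric.infDist y V / 2) ≤
        |c j₀| * |bandFun r k j₀ (Metric.infDist y V)| :=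
      mul_le_mul_of_nonneg_left (h4.trans (le_abs_self _)) hc0.le
    have h6 : |c j₀| / (4 * a) * dist y x < |c j₀| / (4 * a) * (a * Metric.infDist y V) :=
      mul_lt_mul_of_pos_left hy3 (by positivity)
    have h7 : |c j₀| / (4 * a) * (a * Metric.infDist y V) = |c j₀| * Metric.infDist y V / 4 := by
      field_simp
    have h8 : 0 < |c j₀| * Metric.infDist y V := by positivity
    linarith
  have hall : ∀ᵐ x ∂ν, ∀ n : ℕ, x ∈ closure V →
      lipWithin U (fun y => Metric.infDist y V) x ≤ ENNReal.ofReal (1 / ((n : ℝ) + 1)) :=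
    ae_all_iff.2 fun n => key _ (by positivity)
  filter_upwards [hall] with x hx hxV
  have hlim : Tendsto (fun n : ℕ => ENNReal.ofReal (1 / ((n : ℝ) + 1))) atTop (𝓝 0) := by
    have := ENNReal.tendsto_ofReal (tendsto_one_div_add_atTop_nhds_zero_nat (𝕜 := ℝ))
    simpa using this
  exact le_antisymm (ge_of_tendsto' hlim fun n => hx n (subset_closure hxV)) (zero_le)

end Porosity

/-! ### Density points in Euclidean space. -/

section Density

instance isAddHaarMeasure_hausdorffMeasure_euc (k : ℕ) :
    (Measure.hausdorffMeasure (k : ℝ) : Measure (Euc k)).IsAddHaarMeasure := by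
  have := isAddHaarMeasure_hausdorffMeasure (E := Euc k)
  rwa [finrank_euclideanSpace_fin] at this

/-- Almost every point of a set can be reached inside the set from all directions. -/
theorem ae_eventually_exists_smul_mem {k : ℕ} (T : Set (Euc k)) :
    ∀ᵐ z ∂(Measure.hausdorffMeasure (k : ℝ) : Measure (Euc k)), z ∈ T →
      ∀ t : Set (Euc k), IsOpen t → t.Nonempty → ∀ᶠ r in 𝓝[>] (0 : ℝ), ∃ e ∈ t, z + r • e ∈ T := by
  -- This density theorem needs no measurability of `T`, which will be the image of a set under a
  -- chart.
  have h := Besicovitch.ae_tendsto_measure_inter_div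
    (Measure.hausdorffMeasure (k : ℝ) : Measure (Euc k)) T
  have h' := ae_imp_of_ae_restrict h
  filter_upwards [h'] with z hz hzT t ht hne
  have := Measure.eventually_nonempty_inter_smul_of_density_one _ T z (hz hzT) t
    ht.measurableSet (ht.measure_pos _ hne).ne'
  filter_upwards [this] with r hr
  obtain ⟨w, hwT, hw⟩ := hr
  obtain ⟨_, rfl, v, ⟨e, he, rfl⟩, rfl⟩ := hw
  exact ⟨e, he, hwT⟩

end Density

/-! ### Rectifiable charts: Rademacher's theorem and the norm of covectors. -/

section RectifiableChart

variable {X : Type*} [MetricSpace X] {k : ℕ} {K : ℝ} {U V : Set X} {θ : X → Euc k}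

theorem IsBiLipschitzOn.mono (h : IsBiLipschitzOn K U θ) (hVU : V ⊆ U) : IsBiLipschitzOn K V θ :=
  fun x hx y hy => h x (hVU hx) y (hVU hy)

theorem IsBiLipschitzOn.congr {θ' : X → Euc k} (h : IsBiLipschitzOn K U θ) (he : EqOn θ' θ U) :
    IsBiLipschitzOn K U θ' := fun x hx y hy => by
  rw [he hx, he hy]
  exact h x hx y hy

theorem IsBiLipschitzOn.dist_le (h : IsBiLipschitzOn K U θ) (hK : 1 ≤ K) {x y : X} (hx : x ∈ U)
    (hy : y ∈ U) : dist x y ≤ K * dist (θ x) (θ y) := by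
  have := (h x hx y hy).1
  rwa [div_le_iff₀ (by linarith), mul_comm] at this

theorem IsBiLipschitzOn.lipschitzOnWith (h : IsBiLipschitzOn K U θ) :
    LipschitzOnWith K.toNNReal θ U :=
  LipschitzOnWith.of_dist_le_mul fun x hx y hy =>
    (h x hx y hy).2.trans (mul_le_mul_of_nonneg_right (Real.le_coe_toNNReal K) dist_nonneg)

theorem IsBiLipschitzOn.injOn (h : IsBiLipschitzOn K U θ) (hK : 1 ≤ K) : InjOn θ U :=
  fun x hx y hy hxy => by
    have := h.dist_le hK hx hy
    rw [hxy, dist_self, mul_zero] at this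
    exact dist_le_zero.1 this

theorem IsBiLipschitzOn.lipschitzOnWith_invFunOn [Nonempty X] (h : IsBiLipschitzOn K U θ)
    (hK : 1 ≤ K) : LipschitzOnWith K.toNNReal (Function.invFunOn θ U) (θ '' U) := by
  refine LipschitzOnWith.of_dist_le_mul ?_
  rintro _ ⟨x, hx, rfl⟩ _ ⟨y, hy, rfl⟩
  rw [(h.injOn hK).leftInvOn_invFunOn hx, (h.injOn hK).leftInvOn_invFunOn hy,
    Real.coe_toNNReal K (by linarith)]
  exact h.dist_le hK hx hy

theorem IsBiLipschitzOn.lipWithin_le (h : IsBiLipschitzOn K V θ) (hK : 1 ≤ K) {x : X}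
    (hx : x ∈ V) (M : Euc k →L[ℝ] ℝ) :
    lipWithin V (fun y => M (θ y)) x ≤ ENNReal.ofReal K * ‖M‖ₑ := by
  rw [← ofReal_norm, ← ENNReal.ofReal_mul (by linarith)]
  refine lipWithin_le_of_eventually (by positivity) ?_
  filter_upwards [self_mem_nhdsWithin] with y hy
  rw [← map_sub, ← Real.norm_eq_abs]
  have h1 := (h y hy.1 x hx).2
  rw [dist_eq_norm] at h1
  calc ‖M (θ y - θ x)‖ ≤ ‖M‖ * ‖θ y - θ x‖ := M.le_opNorm _
    _ ≤ ‖M‖ * (K * dist y x) := mul_le_mul_of_nonneg_left h1 (norm_nonneg _)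
    _ = K * ‖M‖ * dist y x := by ring

/-- For `c < ‖M‖` the directions `e` of the unit ball with `c < ‖M e‖` form a nonempty open set.
Density yields arbitrarily small `r` and points `y` of `V` with `θ y = θ x + r • e`; there `M ∘ θ`
varies by more than `r c` while `dist y x ≤ K r`. -/
theorem IsBiLipschitzOn.enorm_le_lipWithin (h : IsBiLipschitzOn K V θ) (hK : 1 ≤ K) {x : X}
    (hx : x ∈ V)
    (hdens : ∀ t : Set (Euc k), IsOpen t → t.Nonempty →
      ∀ᶠ r in 𝓝[>] (0 : ℝ), ∃ e ∈ t, θ x + r • e ∈ θ '' V)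
    (M : Euc k →L[ℝ] ℝ) : ‖M‖ₑ ≤ ENNReal.ofReal K * lipWithin V (fun y => M (θ y)) x := by
  have hK0 : 0 < K := by linarith
  have key : ∀ c : ℝ, 0 ≤ c → c < ‖M‖ →
      ENNReal.ofReal (c / K) ≤ lipWithin V (fun y => M (θ y)) x := by
    intro c hc hcM
    obtain ⟨u, hu1, hu2⟩ := M.exists_lt_apply_of_lt_opNorm hcM
    have ht := hdens {e | ‖e‖ < 1 ∧ c < ‖M e‖}
      ((isOpen_lt continuous_norm continuous_const).inter
        (isOpen_lt continuous_const (M.continuous.norm))) ⟨u, hu1, hu2⟩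
    refine le_lipWithin_of_frequently (by positivity) ?_
    rw [frequently_nhdsWithin_iff, Metric.nhds_basis_ball.frequently_iff]
    intro s hs
    have hsm : ∀ᶠ r in 𝓝[>] (0 : ℝ), r < s / K :=
      mem_nhdsWithin_of_mem_nhds (Iio_mem_nhds (by positivity))
    obtain ⟨r, ⟨⟨e, he, y, hyV, hy⟩, hrs⟩, hr⟩ := ((ht.and hsm).and self_mem_nhdsWithin).exists
    have hr0 : 0 < r := hr
    have hd : dist y x ≤ K * (r * ‖e‖) := by
      have := h.dist_le hK hyV hx
      rwa [hy, dist_eq_norm, add_sub_cancel_left, norm_smul, Real.norm_of_nonneg hr0.le] at this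
    have hd' : dist y x ≤ K * r := hd.trans (mul_le_mul_of_nonneg_left
      (mul_le_of_le_one_right hr0.le he.1.le) hK0.le)
    have hM : |M (θ y) - M (θ x)| = r * ‖M e‖ := by
      rw [← map_sub, hy, add_sub_cancel_left, map_smul, smul_eq_mul, abs_mul, abs_of_pos hr0,
        Real.norm_eq_abs]
    refine ⟨y, ?_, ?_, hyV, ?_⟩
    · rw [Metric.mem_ball]
      refine hd'.trans_lt ?_
      rwa [lt_div_iff₀ hK0, mul_comm] at hrs
    · rw [hM]
      calc c / K * dist y x ≤ c / K * (K * r) := mul_le_mul_of_nonneg_left hd' (by positivity)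
        _ = r * c := by field_simp
        _ ≤ r * ‖M e‖ := mul_le_mul_of_nonneg_left he.2.le hr0.le
    · rintro rfl
      rw [sub_self, abs_zero] at hM
      have := mul_pos hr0 (hc.trans_lt he.2)
      linarith
  have h2 : ENNReal.ofReal (‖M‖ / K) ≤ lipWithin V (fun y => M (θ y)) x := by
    rcases (norm_nonneg M).eq_or_lt with h0 | h0
    · simp [← h0]
    · have hc : ContinuousWithinAt (fun c : ℝ => ENNReal.ofReal (c / K)) (Iio ‖M‖) ‖M‖ :=
        (ENNReal.continuous_ofReal.comp (continuous_id.div_const K)).continuousWithinAt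
      refine le_of_tendsto hc ?_
      filter_upwards [self_mem_nhdsWithin,
        mem_nhdsWithin_of_mem_nhds (Ioi_mem_nhds h0)] with c hc hc0
      exact key c (le_of_lt hc0) hc
  calc ‖M‖ₑ = ENNReal.ofReal K * ENNReal.ofReal (‖M‖ / K) := by
        rw [← ENNReal.ofReal_mul hK0.le, ← ofReal_norm]
        congr 1
        field_simp
    _ ≤ _ := mul_le_mul_right h2 _

variable [MeasurableSpace X] [BorelSpace X] {m : Measure X}

theorem IsRectifiableChart.mono (h : IsRectifiableChart m U θ) (hVU : V ⊆ U)
    (hV : MeasurableSet V) : IsRectifiableChart m V θ where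
  measurableSet := hV
  biLipschitz := h.biLipschitz.imp fun _ hK => ⟨hK.1, hK.2.mono hVU⟩
  absolutelyContinuous := by
    have := h.absolutelyContinuous.restrict V
    rwa [Measure.restrict_restrict hV, Measure.restrict_restrict hV,
      inter_eq_self_of_subset_left hVU] at this

theorem IsRectifiableChart.congr {θ' : X → Euc k} (h : IsRectifiableChart m U θ)
    (he : EqOn θ' θ U) : IsRectifiableChart m U θ' where
  measurableSet := h.measurableSet
  biLipschitz := h.biLipschitz.imp fun _ hK => ⟨hK.1, hK.2.congr he⟩
  absolutelyContinuous := h.absolutelyContinuous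

/-- The Lipschitz inverse of `θ` carries null sets of the `k`-dimensional Hausdorff measure to null
sets, and these are `m`-null inside `U` by absolute continuity. -/
theorem IsRectifiableChart.ae_of_ae_hausdorff (h : IsRectifiableChart m U θ) {p : Euc k → Prop}
    (hp : ∀ᵐ z ∂(Measure.hausdorffMeasure (k : ℝ) : Measure (Euc k)), p z) :
    ∀ᵐ x ∂m, x ∈ U → p (θ x) := by
  rcases isEmpty_or_nonempty X with hX | hX
  · exact Eventually.of_forall fun x => hX.elim x
  obtain ⟨K, hK, hθ⟩ := h.biLipschitz
  rw [← ae_restrict_iff' h.measurableSet]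
  refine h.absolutelyContinuous.ae_le ?_
  change ∀ᵐ x ∂_, p (θ x)
  rw [ae_restrict_iff' h.measurableSet, ae_iff]
  have hN : Measure.hausdorffMeasure (k : ℝ) (θ '' U ∩ {z | ¬ p z}) = 0 :=
    measure_mono_null inter_subset_right hp
  have himg := ((hθ.lipschitzOnWith_invFunOn hK).mono
    (inter_subset_left (t := {z | ¬ p z}))).hausdorffMeasure_image_le (Nat.cast_nonneg k)
  rw [hN, mul_zero] at himg
  refine measure_mono_null ?_ (le_antisymm himg (zero_le))
  intro x hx
  simp only [Set.mem_ofPred_eq, Classical.not_imp] at hx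
  exact ⟨θ x, ⟨mem_image_of_mem _ hx.1, hx.2⟩, (hθ.injOn hK).leftInvOn_invFunOn hx.1⟩

theorem IsRectifiableChart.ae_enorm_le_lipWithin (h : IsRectifiableChart m U θ) (hVU : V ⊆ U) :
    ∀ᵐ x ∂m, x ∈ V → ∀ K, 1 ≤ K → IsBiLipschitzOn K U θ → ∀ M : Euc k →L[ℝ] ℝ,
      ‖M‖ₑ ≤ ENNReal.ofReal K * lipWithin V (fun y => M (θ y)) x := by
  filter_upwards [h.ae_of_ae_hausdorff (ae_eventually_exists_smul_mem (θ '' V))]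
    with x hx hxV K hK hθ
  exact (hθ.mono hVU).enorm_le_lipWithin hK hxV (hx (hVU hxV) (mem_image_of_mem _ hxV))

/-- Rademacher's theorem for `f ∘ θ⁻¹` on `θ '' V`. Testing with functionals `N` expresses the
first-order expansion of a vector-valued map through the real-valued `lipWithin`. -/
theorem IsRectifiableChart.ae_exists_differential {F : Type*} [NormedAddCommGroup F]
    [NormedSpace ℝ F] [FiniteDimensional ℝ F] (h : IsRectifiableChart m U θ) (hVU : V ⊆ U)
    {f : X → F} {C : NNReal} (hf : LipschitzOnWith C f V) :
    ∀ᵐ x ∂m, x ∈ V → ∃ R : Euc k →L[ℝ] F, ∀ N : F →L[ℝ] ℝ,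
      lipWithin V (fun y => N (f y - R (θ y))) x = 0 := by
  rcases isEmpty_or_nonempty X with hX | hX
  · exact Eventually.of_forall fun x => hX.elim x
  obtain ⟨K, hK, hθ⟩ := h.biLipschitz
  replace hθ := hθ.mono hVU
  have hK0 : 0 < K := by linarith
  set g := Function.invFunOn θ V with hg
  have hgθ : ∀ y ∈ V, g (θ y) = y := fun y hy => (hθ.injOn hK).leftInvOn_invFunOn hy
  have hgV : MapsTo g (θ '' V) V := by
    rintro _ ⟨y, hy, rfl⟩
    rwa [hgθ y hy]
  have hlip : LipschitzOnWith (C * K.toNNReal) (f ∘ g) (θ '' V) :=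
    hf.comp (hθ.lipschitzOnWith_invFunOn hK) hgV
  filter_upwards [h.ae_of_ae_hausdorff (hlip.ae_differentiableWithinAt_of_mem
    (μ := Measure.hausdorffMeasure (k : ℝ)))] with x hx hxV
  obtain ⟨R, hR⟩ := hx (hVU hxV) (mem_image_of_mem _ hxV)
  refine ⟨R, fun N => lipWithin_eq_zero_iff.2 fun ε hε => ?_⟩
  have ho := hR.isLittleO.def (c := ε / (K * (‖N‖ + 1))) (by positivity)
  have htend : Tendsto θ (𝓝[V] x) (𝓝[θ '' V] (θ x)) :=
    tendsto_nhdsWithin_of_tendsto_nhds_of_eventually_within _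
      (hθ.lipschitzOnWith.continuousOn x hxV)
      (by filter_upwards [self_mem_nhdsWithin] with y hy using mem_image_of_mem _ hy)
  have hev := (htend.eventually ho).filter_mono (nhdsWithin_mono x (sdiff_subset (t := {x})))
  filter_upwards [hev, self_mem_nhdsWithin] with y hy hyV
  simp only [Function.comp_apply, hgθ y hyV.1, hgθ x hxV] at hy
  have h1 := (hθ y hyV.1 x hxV).2
  rw [dist_eq_norm] at h1
  rw [← map_sub, ← Real.norm_eq_abs]
  have e : f y - R (θ y) - (f x - R (θ x)) = f y - f x - R (θ y - θ x) := by
    rw [map_sub]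
    abel
  rw [e]
  calc ‖N (f y - f x - R (θ y - θ x))‖ ≤ ‖N‖ * ‖f y - f x - R (θ y - θ x)‖ := N.le_opNorm _
    _ ≤ (‖N‖ + 1) * (ε / (K * (‖N‖ + 1)) * (K * dist y x)) := by
      refine mul_le_mul (by linarith) (hy.trans ?_) (norm_nonneg _) (by positivity)
      exact mul_le_mul_of_nonneg_left h1 (by positivity)
    _ = ε * dist y x := by field_simp

/-- Rectifiable charts, extended to Lipschitz maps, are weak charts. -/
theorem IsRectifiableChart.isWeakChart (h : IsRectifiableChart m U θ) (hU : 0 < m U)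
    (hlip : ∃ C, LipschitzWith C θ) : IsWeakChart m U θ where
  measurableSet := h.measurableSet
  measure_pos := hU
  lipschitz := hlip
  existsUnique_differential := by
    rintro f ⟨C, hf⟩
    obtain ⟨K, hK, hθ⟩ := h.biLipschitz
    rw [ae_restrict_iff' h.measurableSet]
    filter_upwards [h.ae_exists_differential subset_rfl hf.lipschitzOnWith,
      h.ae_enorm_le_lipWithin subset_rfl] with x hx hx' hxU
    obtain ⟨L, hL⟩ := hx hxU
    have hL1 : lipWithin U (fun y => f y - L (θ y)) x = 0 := hL (ContinuousLinearMap.id ℝ ℝ)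
    refine ⟨L, hL1, fun L' hL' => ?_⟩
    -- Two differentials differ by a covector that is constant to first order along `U`; the lower
    -- bound on `lipWithin` then makes its norm vanish.
    have h1 : lipWithin U (fun y => (L' - L) (θ y)) x = 0 := by
      have h2 : lipWithin U (fun y => (f y - L (θ y)) + -(f y - L' (θ y))) x = 0 := by
        refine le_antisymm (lipWithin_add_le.trans ?_) (zero_le)
        rw [lipWithin_neg, hL1, hL', add_zero]
      rw [← h2]
      congr 1
      funext y
      simp
    have h3 := hx' hxU K hK hθ (L' - L)
    rw [h1, mul_zero, ← ofReal_norm, nonpos_iff_eq_zero, ENNReal.ofReal_eq_zero,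
      norm_le_zero_iff] at h3
    exact sub_eq_zero.1 h3

end RectifiableChart

/-! ### The fibers of the concrete tangent bundle are Euclidean. -/

section TangentSpace

variable {X : Type*} [MetricSpace X] {k l : ℕ} {U W : Set X} {φ : X → Euc k} {θ : X → Euc l}

/-- A proper subspace is annihilated by a nonzero functional. -/
theorem surjective_of_comp_eq_zero {R : Euc l →L[ℝ] Euc k}
    (h : ∀ L : Euc k →L[ℝ] ℝ, L.comp R = 0 → L = 0) : Function.Surjective R := by
  rw [← ContinuousLinearMap.coe_coe, ← LinearMap.range_eq_top]
  by_contra hne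
  obtain ⟨f, hf0, hf⟩ := Submodule.exists_le_ker_of_lt_top _ (lt_top_iff_ne_top.2 hne)
  refine hf0 ?_
  have := h (LinearMap.toContinuousLinearMap f) (by
    ext v
    exact hf (LinearMap.mem_range_self _ v))
  ext v
  exact congrArg (fun L : Euc k →L[ℝ] ℝ => L v) this

theorem cotangentNorm_zero (U : Set X) (φ : X → Euc k) (x : X) : cotangentNorm U φ x 0 = 0 := by
  simpa using cotangentNorm_smul U φ x 0 0

/-- A covector norm which is up to factors `K` arbitrarily close to `1` the operator norm in
suitable linear coordinates, is the operator norm in some linear coordinates. -/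
theorem exists_equiv_cotangentNorm_eq {C : NNReal} (hφ : LipschitzWith C φ) {x : X}
    (h0 : ∀ L, cotangentNorm U φ x L = 0 → L = 0)
    (h : ∀ n : ℕ, ∃ R : Euc k →L[ℝ] Euc k, ∀ L : Euc k →L[ℝ] ℝ,
      ‖L.comp R‖ₑ ≤ ENNReal.ofReal (1 + 1 / ((n : ℝ) + 1)) * cotangentNorm U φ x L ∧
      cotangentNorm U φ x L ≤ ENNReal.ofReal (1 + 1 / ((n : ℝ) + 1)) * ‖L.comp R‖ₑ) :
    ∃ R : Euc k ≃L[ℝ] Euc k, ∀ L : Euc k →L[ℝ] ℝ,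
      cotangentNorm U φ x L = ‖L.comp (R : Euc k →L[ℝ] Euc k)‖ₑ := by
  choose R hR using h
  have hbound : ∀ n, R n ∈ Metric.closedBall (0 : Euc k →L[ℝ] Euc k) (2 * C) := by
    intro n
    rw [mem_closedBall_zero_iff]
    -- Testing with the covector `⟨R n v, ·⟩` gives `‖R n v‖² ≤ 2 C ‖R n v‖ ‖v‖`, where 2 bounds `1
    -- + 1 / (n + 1)`. The sequence is thus bounded and has a convergent subsequence.
    refine ContinuousLinearMap.opNorm_le_bound _ (by positivity) fun v => ?_
    have h1 := (hR n (innerSL ℝ (R n v))).1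
    have h2 : cotangentNorm U φ x (innerSL ℝ (R n v)) ≤ ENNReal.ofReal (C * ‖R n v‖) := by
      refine (cotangentNorm_le U hφ x _ 0).trans ?_
      rw [cotangentNorm_zero, zero_add, edist_zero_right, ENNReal.ofReal_mul C.coe_nonneg, ← ofReal_norm,
        innerSL_apply_norm, ENNReal.ofReal_coe_nnreal]
    have hn : 1 + 1 / ((n : ℝ) + 1) ≤ 2 := by
      have : 1 / ((n : ℝ) + 1) ≤ 1 := by
        rw [div_le_one (by positivity)]
        have : (0 : ℝ) ≤ n := n.cast_nonneg
        linarith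
      linarith
    have h3 : ‖(innerSL ℝ (R n v)).comp (R n)‖ ≤ 2 * (C * ‖R n v‖) := by
      have := h1.trans (mul_le_mul' (ENNReal.ofReal_le_ofReal hn) h2)
      rw [← ENNReal.ofReal_mul (by norm_num), ← ofReal_norm,
        ENNReal.ofReal_le_ofReal_iff (by positivity)] at this
      exact this
    have h4 := ((innerSL ℝ (R n v)).comp (R n)).le_opNorm v
    rw [ContinuousLinearMap.comp_apply, innerSL_apply_apply, real_inner_self_eq_norm_sq,
      Real.norm_of_nonneg (by positivity)] at h4
    have h5 := mul_le_mul_of_nonneg_right h3 (norm_nonneg v)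
    rcases (norm_nonneg (R n v)).eq_or_lt with h6 | h6
    · rw [← h6]
      positivity
    · refine le_of_mul_le_mul_left ?_ h6
      nlinarith
  have : ProperSpace (Euc k →L[ℝ] Euc k) := FiniteDimensional.proper ℝ _
  obtain ⟨R₀, -, s, hs, hlim⟩ := (isCompact_closedBall _ _).tendsto_subseq hbound
  have hcomp : ∀ L : Euc k →L[ℝ] ℝ,
      Tendsto (fun n => ‖L.comp (R (s n))‖ₑ) atTop (𝓝 ‖L.comp R₀‖ₑ) := by
    intro L
    have hc : Continuous fun R : Euc k →L[ℝ] Euc k => ‖L.comp R‖ₑ :=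
      continuous_enorm.comp (by fun_prop)
    exact (hc.tendsto R₀).comp hlim
  have hK : Tendsto (fun n => ENNReal.ofReal (1 + 1 / ((s n : ℝ) + 1))) atTop (𝓝 1) := by
    have h1 := (tendsto_one_div_add_atTop_nhds_zero_nat (𝕜 := ℝ)).comp hs.tendsto_atTop
    have := ENNReal.tendsto_ofReal (h1.const_add 1)
    simpa using this
  have heq : ∀ L : Euc k →L[ℝ] ℝ, cotangentNorm U φ x L = ‖L.comp R₀‖ₑ := by
    intro L
    apply le_antisymm
    · have h1 := ENNReal.Tendsto.mul hK (Or.inr enorm_ne_top) (hcomp L) (Or.inr ENNReal.one_ne_top)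
      rw [one_mul] at h1
      exact ge_of_tendsto' h1 fun n => (hR (s n) L).2
    · have h1 := ENNReal.Tendsto.mul_const (b := cotangentNorm U φ x L) hK
        (Or.inr (cotangentNorm_ne_top U hφ x L))
      rw [one_mul] at h1
      exact le_of_tendsto_of_tendsto' (hcomp L) h1 fun n => (hR (s n) L).1
  -- Limits of invertible maps may degenerate; here the definiteness `h0` of the covector norm rules
  -- this out.
  have hsurj : Function.Surjective R₀ := surjective_of_comp_eq_zero fun L hL => by
    refine h0 L ?_
    rw [heq, hL, ← ofReal_norm, norm_zero, ENNReal.ofReal_zero]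
  have hinj : Function.Injective R₀ :=
    (LinearMap.injective_iff_surjective (f := (R₀ : Euc k →ₗ[ℝ] Euc k))).2 hsurj
  refine ⟨(LinearEquiv.ofBijective (R₀ : Euc k →ₗ[ℝ] Euc k) ⟨hinj, hsurj⟩).toContinuousLinearEquiv,
    fun L => ?_⟩
  rw [heq]
  rfl

/-- Self-duality of the Euclidean norm, transported by `R`. -/
theorem tangentNorm_apply_of_cotangentNorm_eq {x : X} (R : Euc k ≃L[ℝ] Euc k)
    (h : ∀ L : Euc k →L[ℝ] ℝ, cotangentNorm U φ x L = ‖L.comp (R : Euc k →L[ℝ] Euc k)‖ₑ)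
    (ξ : Euc k) : tangentNorm U φ x (R ξ) = ‖ξ‖ₑ := by
  have hiff : ∀ L : Euc k →L[ℝ] ℝ, cotangentNorm U φ x L ≤ 1 ↔
      ‖L.comp (R : Euc k →L[ℝ] Euc k)‖ ≤ 1 := by
    intro L
    rw [h, ← ofReal_norm, ENNReal.ofReal_le_one]
  rw [← ofReal_norm]
  apply le_antisymm
  · refine iSup₂_le fun L hL => ENNReal.ofReal_le_ofReal ?_
    have h1 := (L.comp (R : Euc k →L[ℝ] Euc k)).le_opNorm ξ
    have h2 := mul_le_mul_of_nonneg_right ((hiff L).1 hL) (norm_nonneg ξ)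
    have h3 : L (R ξ) ≤ ‖L.comp (R : Euc k →L[ℝ] Euc k) ξ‖ := le_abs_self _
    linarith
  · rcases eq_or_ne ξ 0 with rfl | hξ
    · simp
    have hξ' : ‖ξ‖ ≠ 0 := norm_ne_zero_iff.2 hξ
    set L : Euc k →L[ℝ] ℝ := (innerSL ℝ ((‖ξ‖)⁻¹ • ξ)).comp (R.symm : Euc k →L[ℝ] Euc k) with hL
    have hLR : L.comp (R : Euc k →L[ℝ] Euc k) = innerSL ℝ ((‖ξ‖)⁻¹ • ξ) := by
      ext v
      simp [hL]
    have h1 : cotangentNorm U φ x L ≤ 1 := by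
      rw [hiff, hLR, innerSL_apply_norm, norm_smul, norm_inv, norm_norm, inv_mul_cancel₀ hξ']
    refine le_trans (le_of_eq ?_) (le_iSup₂ (f := fun (L : Euc k →L[ℝ] ℝ)
      (_ : cotangentNorm U φ x L ≤ 1) => ENNReal.ofReal (L (R ξ))) L h1)
    have h2 : L (R ξ) = ‖ξ‖ := by
      change (L.comp (R : Euc k →L[ℝ] Euc k)) ξ = _
      rw [hLR, innerSL_apply_apply, inner_smul_left, real_inner_self_eq_norm_sq]
      simp only [conj_trivial]
      field_simp
    rw [h2]

variable [MeasurableSpace X] {m : Measure X}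

/-- Such an `L` is, like 0, a differential of the zero function. -/
theorem IsWeakChart.ae_eq_zero_of_cotangentNorm_eq_zero (hU : IsWeakChart m U φ) :
    ∀ᵐ x ∂m, x ∈ U → ∀ L, cotangentNorm U φ x L = 0 → L = 0 := by
  have h := hU.existsUnique_differential (fun _ => 0) ⟨0, LipschitzWith.const 0⟩
  rw [ae_restrict_iff' hU.measurableSet] at h
  filter_upwards [h] with x hx hxU L hL
  refine (hx hxU).unique ?_ ?_
  · simp only [zero_sub, lipWithin_neg]
    exact hL
  · simpa using lipWithin_zero

variable [BorelSpace X]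

/-- The porosity argument requires a finite measure, and an s-finite measure has the same null sets
as a finite one. -/
theorem IsWeakChart.ae_infDist [SFinite m] (hU : IsWeakChart m U φ) (V : Set X) :
    ∀ᵐ x ∂m, x ∈ U → x ∈ V → lipWithin U (fun y => Metric.infDist y V) x = 0 := by
  rw [← ae_restrict_iff' hU.measurableSet, ← ae_toFinite]
  refine ae_lipWithin_infDist_eq_zero _ U V φ fun f hf => ?_
  rw [ae_toFinite]
  filter_upwards [hU.existsUnique_differential f hf] with x hx using hx.exists

/-- Comparison of a weak chart with a bi-Lipschitz chart: the dimensions agree, and the covector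
norm of the former is, in suitable linear coordinates, almost the Euclidean norm. -/
theorem IsWeakChart.ae_cotangentNorm [SFinite m] (hU : IsWeakChart m U φ)
    (hW : IsRectifiableChart m W θ) :
    ∀ᵐ x ∂m, x ∈ U → x ∈ W → l = k ∧ ∀ K, 1 ≤ K → IsBiLipschitzOn K W θ →
      ∃ R : Euc l →L[ℝ] Euc k, ∀ L : Euc k →L[ℝ] ℝ,
        ‖L.comp R‖ₑ ≤ ENNReal.ofReal K * cotangentNorm U φ x L ∧
        cotangentNorm U φ x L ≤ ENNReal.ofReal K * ‖L.comp R‖ₑ := by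
  obtain ⟨C, hφ⟩ := hU.lipschitz
  obtain ⟨K₀, hK₀, hθ₀⟩ := hW.biLipschitz
  -- Weak charts differentiate functions that are Lipschitz on all of `X`, whereas `θ` is controlled
  -- only on `W`.
  obtain ⟨θ', hθ', heq⟩ := hθ₀.lipschitzOnWith.extend_finite_dimension
  have hVW : U ∩ W ⊆ W := inter_subset_right
  have hcoord : ∀ᵐ x ∂m, ∀ j : Fin l, x ∈ U → ∃ S : Euc k →L[ℝ] ℝ,
      lipWithin U (fun y => (EuclideanSpace.proj j : Euc l →L[ℝ] ℝ) (θ' y) - S (φ y)) x = 0 := by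
    rw [ae_all_iff]
    intro j
    have h := hU.existsUnique_differential
      (fun y => (EuclideanSpace.proj j : Euc l →L[ℝ] ℝ) (θ' y))
      ⟨_, (ContinuousLinearMap.lipschitz _).comp hθ'⟩
    rw [ae_restrict_iff' hU.measurableSet] at h
    filter_upwards [h] with x hx hxU using (hx hxU).exists
  filter_upwards [hU.ae_eq_zero_of_cotangentNorm_eq_zero, hU.ae_infDist (U ∩ W), hcoord,
    hW.ae_enorm_le_lipWithin hVW, hW.ae_exists_differential hVW hφ.lipschitzOnWith]
    with x h0 hdist hS hlow hR hxU hxW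
  have hxV : x ∈ U ∩ W := ⟨hxU, hxW⟩
  obtain ⟨R, hR⟩ := hR hxV
  have hcot : ∀ L : Euc k →L[ℝ] ℝ, cotangentNorm U φ x L =
      lipWithin (U ∩ W) (fun y => (L.comp R) (θ y)) x := by
    intro L
    rw [cotangentNorm, lipWithin_eq_of_infDist (f := fun y => L (φ y)) (L.lipschitz.comp hφ) inter_subset_left hxV
      (hdist hxU hxV)]
    refine lipWithin_congr_of_sub_eq_zero ?_
    have := hR L
    simp only [map_sub] at this
    exact this
  have hsurj : Function.Surjective R := surjective_of_comp_eq_zero fun L hL => by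
    refine h0 hxU L ?_
    rw [hcot, hL]
    simpa using lipWithin_zero
  -- The differentials `S` of the coordinates of `θ'` with respect to `φ` invert `R` from the left:
  -- by the chain rule the `j`-th coordinate minus `S ∘ R` has zero Lipschitz constant along `V`,
  -- hence vanishes.
  have hinj : Function.Injective R := by
    rw [injective_iff_map_eq_zero]
    intro v hv
    ext j
    obtain ⟨S, hS⟩ := hS j hxU
    have h1 : lipWithin (U ∩ W)
        (fun y => ((EuclideanSpace.proj j : Euc l →L[ℝ] ℝ) - S.comp R) (θ y)) x = 0 := by
      have h2 : lipWithin (U ∩ W)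
          (fun y => (EuclideanSpace.proj j : Euc l →L[ℝ] ℝ) (θ y) - S (φ y)) x = 0 := by
        rw [← lipWithin_eq_zero_of_subset inter_subset_left hS]
        refine lipWithin_congr_on (fun y hy => ?_) hxV
        simp only [heq hy.2]
      have h3 := lipWithin_add_le (U := U ∩ W) (x := x)
        (f := fun y => (EuclideanSpace.proj j : Euc l →L[ℝ] ℝ) (θ y) - S (φ y))
        (g := fun y => S (φ y - R (θ y)))
      rw [h2, hR S, add_zero, nonpos_iff_eq_zero] at h3
      rw [← h3]
      congr 1
      funext y
      simp
    have h4 := hlow hxV K₀ hK₀ hθ₀ ((EuclideanSpace.proj j : Euc l →L[ℝ] ℝ) - S.comp R)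
    rw [h1, mul_zero, ← ofReal_norm, nonpos_iff_eq_zero, ENNReal.ofReal_eq_zero,
      norm_le_zero_iff] at h4
    have h5 := congrArg (fun M : Euc l →L[ℝ] ℝ => M v) h4
    simpa [hv] using h5
  refine ⟨?_, fun K hK hθ => ⟨R, fun L => ?_⟩⟩
  · have := (LinearEquiv.ofBijective (R : Euc l →ₗ[ℝ] Euc k) ⟨hinj, hsurj⟩).finrank_eq
    simpa using this
  · rw [hcot]
    exact ⟨hlow hxV K hK hθ _, (hθ.mono hVW).lipWithin_le hK hxV _⟩

theorem IsWeakChart.ae_dim_eq [SFinite m] (hU : IsWeakChart m U φ) {A : Set X}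
    (hA : IsRectifiableSet m l A) : ∀ᵐ x ∂m, x ∈ U → x ∈ A → l = k := by
  obtain ⟨W, θ, hW, hcov⟩ := hA
  have h1 : ∀ᵐ x ∂m, ∀ j, x ∈ U → x ∈ W j → l = k := by
    rw [ae_all_iff]
    intro j
    filter_upwards [hU.ae_cotangentNorm (hW j)] with x hx hxU hxW using (hx hxU hxW).1
  have h2 : ∀ᵐ x ∂m, x ∉ A \ ⋃ j, W j := measure_eq_zero_iff_ae_notMem.1 hcov
  filter_upwards [h1, h2] with x hx hx' hxU hxA
  have : x ∈ ⋃ j, W j := by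
    by_contra hcon
    exact hx' ⟨hxA, hcon⟩
  obtain ⟨j, hj⟩ := mem_iUnion.1 this
  exact hx j hxU hj

theorem StronglyRectifiable.ae_exists_tangentNorm_eq [SFinite m] (hX : StronglyRectifiable m)
    (hU : IsWeakChart m U φ) :
    ∀ᵐ x ∂m, x ∈ U → ∃ R : Euc k ≃L[ℝ] Euc k, ∀ ξ, tangentNorm U φ x (R ξ) = ‖ξ‖ₑ := by
  obtain ⟨C, hφ⟩ := hU.lipschitz
  have h : ∀ᵐ x ∂m, ∀ n : ℕ, x ∈ U → ∃ R : Euc k →L[ℝ] Euc k, ∀ L : Euc k →L[ℝ] ℝ,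
      ‖L.comp R‖ₑ ≤ ENNReal.ofReal (1 + 1 / ((n : ℝ) + 1)) * cotangentNorm U φ x L ∧
      cotangentNorm U φ x L ≤ ENNReal.ofReal (1 + 1 / ((n : ℝ) + 1)) * ‖L.comp R‖ₑ := by
    rw [ae_all_iff]
    intro n
    have hn : (0 : ℝ) < 1 / ((n : ℝ) + 1) := by positivity
    obtain ⟨dim, W, θ, hW, hcov⟩ := hX _ hn
    have h1 : ∀ᵐ x ∂m, x ∉ (⋃ j, W j)ᶜ := measure_eq_zero_iff_ae_notMem.1 hcov
    have h2 := ae_all_iff.2 fun j => hU.ae_cotangentNorm (hW j).1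
    filter_upwards [h1, h2] with x hx hx' hxU
    obtain ⟨j, hj⟩ := mem_iUnion.1 (notMem_compl_iff.1 hx)
    obtain ⟨hdim, hR⟩ := hx' j hxU hj
    -- The chart `θ j` takes values in `Euc (dim j)`; generalizing it permits rewriting `dim j` to
    -- `k`.
    have hbi := (hW j).2
    generalize θ j = θj at hbi hR
    revert θj
    rw [hdim]
    intro θj hbi hR
    exact hR _ (by linarith) hbi
  filter_upwards [h, hU.ae_eq_zero_of_cotangentNorm_eq_zero] with x hx hx0 hxU
  obtain ⟨R, hR⟩ := exists_equiv_cotangentNorm_eq hφ (hx0 hxU) fun n => hx n hxU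
  exact ⟨R, tangentNorm_apply_of_cotangentNorm_eq R hR⟩

end TangentSpace

/-! ### Measurable orthonormal frames. -/

section Frame

/-- The polarization of a norm. -/
def polar {k : ℕ} (p : Euc k → ℝ≥0∞) (ξ η : Euc k) : ℝ :=
  ((p (ξ + η)).toReal ^ 2 - (p (ξ - η)).toReal ^ 2) / 4

theorem polar_eq_inner {k : ℕ} {p : Euc k → ℝ≥0∞} {R : Euc k ≃L[ℝ] Euc k}
    (h : ∀ ξ, p (R ξ) = ‖ξ‖ₑ) (ξ η : Euc k) : polar p ξ η = inner ℝ (R.symm ξ) (R.symm η) := by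
  have hp : ∀ ξ, (p ξ).toReal = ‖R.symm ξ‖ := fun ξ => by
    rw [← toReal_enorm, ← h, R.apply_symm_apply]
  rw [polar, hp, hp, map_add, map_sub, norm_add_sq_real, norm_sub_sq_real]
  ring

variable {X : Type*} [MeasurableSpace X] {k : ℕ} {N : X → Euc k → ℝ≥0∞}

theorem measurable_polar (hN : ∀ v : X → Euc k, Measurable v → Measurable fun x => N x (v x))
    {v w : X → Euc k} (hv : Measurable v) (hw : Measurable w) :
    Measurable fun x => polar (N x) (v x) (w x) :=
  (((hN _ (hv.add hw)).ennreal_toReal.pow_const 2).sub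
    ((hN _ (hv.sub hw)).ennreal_toReal.pow_const 2)).div_const 4

/-- Measurable Gram–Schmidt orthonormalization of the standard basis. -/
theorem exists_measurable_orthonormal
    (hN : ∀ v : X → Euc k, Measurable v → Measurable fun x => N x (v x)) {G : Set X}
    (hG : ∀ x ∈ G, ∃ R : Euc k ≃L[ℝ] Euc k, ∀ ξ, N x (R ξ) = ‖ξ‖ₑ) {n : ℕ} (hn : n ≤ k) :
    ∃ e : ℕ → X → Euc k, (∀ i, Measurable (e i)) ∧ ∀ x ∈ G,
      (∀ i < n, ∀ j : Fin k, i < j → e i x j = 0) ∧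
      ∀ i < n, ∀ j < n, polar (N x) (e i x) (e j x) = if i = j then 1 else 0 := by
  induction n with
  | zero => exact ⟨fun _ _ => 0, fun _ => measurable_const, fun x _ => by simp⟩
  | succ n ih =>
    obtain ⟨e, he, horth⟩ := ih (by omega)
    set b : Euc k := EuclideanSpace.single ⟨n, hn⟩ 1 with hb
    set w : X → Euc k := fun x => b - ∑ i ∈ Finset.range n, polar (N x) (e i x) b • e i x with hw
    have hwm : Measurable w := measurable_const.sub (Finset.measurable_fun_sum _ fun i _ =>
      (measurable_polar hN (he i) measurable_const).smul (he i))
    set u : X → Euc k := fun x => (√(polar (N x) (w x) (w x)))⁻¹ • w x with hu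
    have hum : Measurable u := (measurable_polar hN hwm hwm).sqrt.inv.smul hwm
    refine ⟨fun i => if i = n then u else e i, fun i => ?_, fun x hx => ?_⟩
    · by_cases hi : i = n
      · simpa [hi] using hum
      · simpa [hi] using he i
    obtain ⟨R, hR⟩ := hG x hx
    obtain ⟨htri, hon⟩ := horth x hx
    have hpol := polar_eq_inner hR
    -- Earlier frame vectors have no coordinates of index `n` or higher, so subtracting them leaves
    -- the `n`-th coordinate of `w` equal to 1. This triangularity is what keeps `w` nonzero.
    have hwj : ∀ j : Fin k, n ≤ j → w x j = b j := by
      intro j hj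
      have : ∀ i ∈ Finset.range n, polar (N x) (e i x) b * e i x j = 0 := by
        intro i hi
        rw [htri i (Finset.mem_range.1 hi) j (by have := Finset.mem_range.1 hi; omega), mul_zero]
      simp [hw, Finset.sum_eq_zero this]
    have hw0 : w x ≠ 0 := by
      intro h0
      have := hwj ⟨n, hn⟩ le_rfl
      rw [h0] at this
      simp [hb] at this
    have hww : polar (N x) (w x) (w x) = ‖R.symm (w x)‖ ^ 2 := by
      rw [hpol, real_inner_self_eq_norm_sq]
    have hRw : ‖R.symm (w x)‖ ≠ 0 := by
      rw [norm_ne_zero_iff]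
      simpa using hw0
    have hue : R.symm (u x) = ‖R.symm (w x)‖⁻¹ • R.symm (w x) := by
      simp only [hu, map_smul, hww, Real.sqrt_sq (norm_nonneg _)]
    have horth_w : ∀ i < n, inner ℝ (R.symm (e i x)) (R.symm (w x)) = 0 := by
      intro i hi
      have h1 : R.symm (w x) = R.symm b -
          ∑ j ∈ Finset.range n, polar (N x) (e j x) b • R.symm (e j x) := by
        simp [hw, map_sum]
      rw [h1, inner_sub_right, inner_sum, Finset.sum_eq_single i]
      · rw [inner_smul_right, ← hpol (e i x) (e i x), hon i hi i hi, if_pos rfl, mul_one, hpol,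
          sub_self]
      · intro j hj hji
        rw [inner_smul_right, ← hpol, hon i hi j (Finset.mem_range.1 hj), if_neg hji.symm, mul_zero]
      · intro hi'
        exact absurd (Finset.mem_range.2 hi) hi'
    have hiu : ∀ i < n, polar (N x) (e i x) (u x) = 0 := by
      intro i hi
      rw [hpol, hue, inner_smul_right, horth_w i hi, mul_zero]
    have hui : ∀ i < n, polar (N x) (u x) (e i x) = 0 := by
      intro i hi
      rw [hpol, real_inner_comm, ← hpol, hiu i hi]
    have huu : polar (N x) (u x) (u x) = 1 := by
      rw [hpol, hue, inner_smul_left, inner_smul_right, real_inner_self_eq_norm_sq]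
      simp only [conj_trivial]
      field_simp
    constructor
    · intro i hi j hij
      by_cases hin : i = n
      · subst hin
        have hne : (⟨i, hn⟩ : Fin k) ≠ j := by
          rintro rfl
          exact lt_irrefl _ hij
        have := hwj j hij.le
        simp [hu, this, hb, hne.symm]
      · simp only [hin, if_false]
        exact htri i (by omega) j hij
    · intro i hi j hj
      by_cases hin : i = n <;> by_cases hjn : j = n
      · simp [hin, hjn, huu]
      · simp [hin, hjn, hui j (by omega), Ne.symm hjn]
      · simp [hin, hjn, hiu i (by omega)]
      · simp only [hin, hjn, if_false]
        exact hon i (by omega) j (by omega)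

/-- A measurable family of Euclidean norms can be trivialized by a measurable family of linear
isometries. -/
theorem exists_measurable_isometry
    (hN : ∀ v : X → Euc k, Measurable v → Measurable fun x => N x (v x)) {G : Set X}
    (hG : ∀ x ∈ G, ∃ R : Euc k ≃L[ℝ] Euc k, ∀ ξ, N x (R ξ) = ‖ξ‖ₑ) :
    ∃ (S : X → Euc k →ₗ[ℝ] Euc k) (T : X → Euc k → Euc k),
      (∀ v, Measurable v → Measurable fun x => S x (v x)) ∧
      (∀ v, Measurable v → Measurable fun x => T x (v x)) ∧
      ∀ x ∈ G, (∀ c, T x (S x c) = c) ∧ (∀ ξ, S x (T x ξ) = ξ) ∧ ∀ c, N x (S x c) = ‖c‖ₑ := by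
  obtain ⟨e, he, hon⟩ := exists_measurable_orthonormal hN hG le_rfl
  -- The map `S` combines the frame vectors and `T` reads off coordinates by polarization. Both are
  -- explicit formulas in measurable data, so no measurable choice of the maps `R` is needed.
  refine ⟨fun x => ∑ i : Fin k, (EuclideanSpace.proj i : Euc k →L[ℝ] ℝ).toLinearMap.smulRight (e i x),
    fun x ξ => WithLp.toLp 2 fun i : Fin k => polar (N x) (e i x) ξ, fun v hv => ?_, fun v hv => ?_,
    fun x hx => ?_⟩
  · simp only [LinearMap.sum_apply, LinearMap.smulRight_apply]
    refine Finset.measurable_fun_sum _ fun i _ => ?_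
    have hi : Measurable fun x => (EuclideanSpace.proj i : Euc k →L[ℝ] ℝ) (v x) :=
      (ContinuousLinearMap.measurable _).comp hv
    exact hi.smul (he i)
  · exact (WithLp.measurable_toLp 2 _).comp
      (measurable_pi_lambda _ fun i => measurable_polar hN (he i) hv)
  obtain ⟨R, hR⟩ := hG x hx
  have hpol := polar_eq_inner hR
  have hf : Orthonormal ℝ fun i : Fin k => R.symm (e i x) := by
    rw [orthonormal_iff_ite]
    intro i j
    rw [← hpol, (hon x hx).2 i i.2 j j.2]
    simp only [Fin.ext_iff]
  let B : OrthonormalBasis (Fin k) ℝ (Euc k) := OrthonormalBasis.mk hf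
    (hf.linearIndependent.span_eq_top_of_card_eq_finrank' (by simp)).ge
  have hB : ∀ i, B i = R.symm (e i x) := fun i => by simp [B]
  have hS : ∀ c : Euc k, (∑ i : Fin k,
      (EuclideanSpace.proj i : Euc k →L[ℝ] ℝ).toLinearMap.smulRight (e i x)) c =
      R (B.repr.symm c) := by
    intro c
    rw [← B.sum_repr_symm]
    simp [hB, map_sum]
  have hT : ∀ ξ : Euc k, (WithLp.toLp 2 fun i : Fin k => polar (N x) (e i x) ξ) =
      B.repr (R.symm ξ) := by
    intro ξ
    ext i
    rw [B.repr_apply_apply, hB]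
    exact hpol _ _
  refine ⟨fun c => ?_, fun ξ => ?_, fun c => ?_⟩ <;> beta_reduce
  · rw [hT, hS]
    simp
  · rw [hT, hS]
    simp
  · rw [hS, hR, ← ofReal_norm, LinearIsometryEquiv.norm_map, ofReal_norm]

end Frame

/-! ### From fiberwise isometries to isomorphisms of modules. -/

namespace MeasurableBundle

variable {X : Type*} [MeasurableSpace X] {m : Measure X} {B B' : MeasurableBundle m}

theorem ae_exists_mem_dom (B : MeasurableBundle m) : ∀ᵐ x ∂m, ∃ i, x ∈ B.dom i := by
  filter_upwards [measure_eq_zero_iff_ae_notMem.1 B.measure_compl_dom] with x hx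
  exact mem_iUnion.1 (notMem_compl_iff.1 hx)

theorem ae_of_ae_restrict_dom {i : B.ι} {p : X → Prop}
    (h : ∀ᵐ x ∂m.restrict (B.dom i), p x) : ∀ᵐ x ∂m, x ∈ B.dom i → p x :=
  (ae_restrict_iff' (B.measurableSet_dom i)).1 h

theorem ptNorm_eq_fiberNorm (v : B.Section) {i : B.ι} {x : X} (hx : x ∈ B.dom i) :
    ptNorm v x = B.fiberNorm i x (v i x) := by
  rw [ptNorm, tsum_eq_single i, indicator_of_mem hx]
  intro j hj
  exact indicator_of_notMem (fun hxj => (B.disjoint_dom hj).le_bot ⟨hxj, hx⟩) _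

/-- `w` is the image of `v` under the fiberwise map `T`. -/
def IsPush (T : ∀ (i : B.ι) (j : B'.ι), X → Euc (B.dim i) → Euc (B'.dim j)) (v : B.Section)
    (w : B'.Section) : Prop :=
  ∀ᵐ x ∂m, ∀ i j, x ∈ B.dom i → x ∈ B'.dom j → w j x = T i j x (v i x)

/-- On a fixed `B'.dom j` the images coming from the different `B.dom i` are glued along the
countable measurable partition of `B`. -/
theorem exists_isPush (T : ∀ (i : B.ι) (j : B'.ι), X → Euc (B.dim i) → Euc (B'.dim j))
    (hT : ∀ i j v, Measurable v → Measurable fun x => T i j x (v x)) (v : B.Section) :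
    ∃ w : B'.Section, IsPush T v w := by
  have := B.countable_ι
  have := B'.countable_ι
  have h : ∀ j, ∃ w : X →ₘ[m.restrict (B'.dom j)] Euc (B'.dim j),
      ∀ᵐ x ∂m, ∀ i, x ∈ B.dom i → x ∈ B'.dom j → w x = T i j x (v i x) := by
    intro j
    rcases isEmpty_or_nonempty B.ι with hι | hι
    · exact ⟨0, Eventually.of_forall fun x i => hι.elim i⟩
    obtain ⟨f, hf, hfeq⟩ := exists_measurable_piecewise B.dom B.measurableSet_dom
      (fun i x => T i j x (v i x)) (fun i => hT i j _ (v i).measurable) (by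
        intro i i' hne x hx
        exact ((B.disjoint_dom hne).le_bot hx).elim)
    refine ⟨AEEqFun.mk f hf.aestronglyMeasurable, ?_⟩
    filter_upwards [ae_of_ae_restrict_dom (AEEqFun.coeFn_mk f hf.aestronglyMeasurable)]
      with x hx i hi hj
    rw [hx hj, hfeq i hi]
  choose w hw using h
  refine ⟨w, ?_⟩
  filter_upwards [ae_all_iff.2 hw] with x hx i j using hx j i

theorem section_ext {v w : B.Section} (h : ∀ᵐ x ∂m, ∀ i, x ∈ B.dom i → v i x = w i x) :
    v = w := by
  funext i
  refine AEEqFun.ext ((ae_restrict_iff' (B.measurableSet_dom i)).2 ?_)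
  filter_upwards [h] with x hx using hx i

theorem ae_add_apply (v w : B.Section) :
    ∀ᵐ x ∂m, ∀ i, x ∈ B.dom i → (v + w) i x = v i x + w i x := by
  have := B.countable_ι
  exact ae_all_iff.2 fun i => ae_of_ae_restrict_dom (AEEqFun.coeFn_add (v i) (w i))

theorem ae_smul_apply (c : ℝ) (v : B.Section) :
    ∀ᵐ x ∂m, ∀ i, x ∈ B.dom i → (c • v) i x = c • v i x := by
  have := B.countable_ι
  exact ae_all_iff.2 fun i => ae_of_ae_restrict_dom (AEEqFun.coeFn_smul c (v i))

theorem ae_linftySMul_apply (f : Lp ℝ ∞ m) (v : B.Section) :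
    ∀ᵐ x ∂m, ∀ i, x ∈ B.dom i → linftySMul f v i x = f x • v i x := by
  have := B.countable_ι
  exact ae_all_iff.2 fun i => ae_of_ae_restrict_dom (AEEqFun.coeFn_mk _ _)

/-- Fiberwise linear isometries, measurable together with their inverses, induce an isomorphism of
normed modules. -/
theorem nonempty_normedModuleIso
    (S : ∀ (i : B.ι) (j : B'.ι), X → Euc (B.dim i) →ₗ[ℝ] Euc (B'.dim j))
    (T : ∀ (j : B'.ι) (i : B.ι), X → Euc (B'.dim j) → Euc (B.dim i))
    (hS : ∀ i j v, Measurable v → Measurable fun x => S i j x (v x))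
    (hT : ∀ j i v, Measurable v → Measurable fun x => T j i x (v x))
    (h : ∀ i j, ∀ᵐ x ∂m, x ∈ B.dom i → x ∈ B'.dom j →
      (∀ ξ, T j i x (S i j x ξ) = ξ) ∧ (∀ η, S i j x (T j i x η) = η) ∧
      ∀ ξ, B'.fiberNorm j x (S i j x ξ) = B.fiberNorm i x ξ) :
    Nonempty (NormedModuleIso B B') := by
  have := B.countable_ι
  have := B'.countable_ι
  have h' := ae_all_iff.2 fun i => ae_all_iff.2 fun j => h i j
  choose F hF using exists_isPush (B := B) (B' := B') (fun i j x ξ => S i j x ξ) hS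
  choose G hG using exists_isPush (B := B') (B' := B) T hT
  have hadd : ∀ v w, F (v + w) = F v + F w := by
    intro v w
    refine section_ext ?_
    filter_upwards [hF v, hF w, hF (v + w), ae_add_apply v w, ae_add_apply (F v) (F w),
      B.ae_exists_mem_dom] with x hv hw hvw ha ha' ⟨i, hi⟩ j hj
    rw [hvw i j hi hj, ha' j hj, hv i j hi hj, hw i j hi hj, ha i hi, map_add]
  have hsmul : ∀ (c : ℝ) v, F (c • v) = c • F v := by
    intro c v
    refine section_ext ?_
    filter_upwards [hF v, hF (c • v), ae_smul_apply c v, ae_smul_apply c (F v),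
      B.ae_exists_mem_dom] with x hv hcv ha ha' ⟨i, hi⟩ j hj
    rw [hcv i j hi hj, ha' j hj, hv i j hi hj, ha i hi, map_smul]
  have hlinfty : ∀ (f : Lp ℝ ∞ m) v, F (linftySMul f v) = linftySMul f (F v) := by
    intro f v
    refine section_ext ?_
    filter_upwards [hF v, hF (linftySMul f v), ae_linftySMul_apply f v,
      ae_linftySMul_apply f (F v), B.ae_exists_mem_dom] with x hv hcv ha ha' ⟨i, hi⟩ j hj
    rw [hcv i j hi hj, ha' j hj, hv i j hi hj, ha i hi, map_smul]
  have hGF : ∀ v, G (F v) = v := by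
    intro v
    refine section_ext ?_
    filter_upwards [hF v, hG (F v), h', B'.ae_exists_mem_dom] with x hv hw hx ⟨j, hj⟩ i hi
    rw [hw j i hj hi, hv i j hi hj, (hx i j hi hj).1]
  have hFG : ∀ w, F (G w) = w := by
    intro w
    refine section_ext ?_
    filter_upwards [hF (G w), hG w, h', B.ae_exists_mem_dom] with x hv hw hx ⟨i, hi⟩ j hj
    rw [hv i j hi hj, hw j i hj hi, (hx i j hi hj).2.1]
  have hnorm : ∀ v, ptNorm (F v) =ᵐ[m] ptNorm v := by
    intro v
    filter_upwards [hF v, h', B.ae_exists_mem_dom, B'.ae_exists_mem_dom]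
      with x hv hx ⟨i, hi⟩ ⟨j, hj⟩
    rw [ptNorm_eq_fiberNorm _ hi, ptNorm_eq_fiberNorm _ hj, hv i j hi hj, (hx i j hi hj).2.2]
  have hint : ∀ v, ∫⁻ x, ptNorm (F v) x ^ 2 ∂m = ∫⁻ x, ptNorm v x ^ 2 ∂m := fun v =>
    lintegral_congr_ae ((hnorm v).mono fun x hx => by simp only [hx])
  have hFmem : ∀ v, v ∈ B.L2 → F v ∈ B'.L2 := fun v hv => (hint v).trans_lt hv
  -- Integrability of `G w` follows from that of `F (G w) = w`, so no norm identity for `T` is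
  -- required.
  have hGmem : ∀ w, w ∈ B'.L2 → G w ∈ B.L2 := fun w hw => by
    have h1 := hint (G w)
    rw [hFG] at h1
    exact h1.symm.trans_lt hw
  exact ⟨{
    toLinearEquiv :=
      { toFun := fun v => ⟨F v, hFmem v v.2⟩
        map_add' := fun v w => Subtype.ext (hadd v w)
        map_smul' := fun c v => Subtype.ext (hsmul c v)
        invFun := fun w => ⟨G w, hGmem w w.2⟩
        left_inv := fun v => Subtype.ext (hGF v)
        right_inv := fun w => Subtype.ext (hFG w) }
    map_linfty_smul := fun f v => Subtype.ext (hlinfty f v)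
    ptNorm_map := fun v => hnorm v }⟩

end MeasurableBundle

/-- The inverse of an isomorphism of normed modules. -/
def NormedModuleIso.symm {X : Type*} [MeasurableSpace X] {m : Measure X}
    {B B' : MeasurableBundle m} (I : NormedModuleIso B B') : NormedModuleIso B' B where
  toLinearEquiv := I.toLinearEquiv.symm
  map_linfty_smul f w := I.toLinearEquiv.injective (by
    rw [I.map_linfty_smul, LinearEquiv.apply_symm_apply, LinearEquiv.apply_symm_apply])
  ptNorm_map w := by
    have := I.ptNorm_map (I.toLinearEquiv.symm w)
    rw [LinearEquiv.apply_symm_apply] at this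
    exact this.symm

/-! ### Existence of atlases and dimensional decompositions. -/

section Existence

variable {X : Type*} [MetricSpace X] [MeasurableSpace X] [BorelSpace X] {m : Measure X}

theorem isRectifiableChart_empty (m : Measure X) {k : ℕ} (θ : X → Euc k) :
    IsRectifiableChart m ∅ θ where
  measurableSet := MeasurableSet.empty
  biLipschitz := ⟨1, le_rfl, fun x hx => hx.elim⟩
  absolutelyContinuous := by simp

/-- The charts of a single decomposition are grouped by dimension and the resulting unions made
disjoint. -/
theorem StronglyRectifiable.nonempty_dimensionalDecomposition (hX : StronglyRectifiable m) :
    Nonempty (DimensionalDecomposition m) := by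
  obtain ⟨dim, U, φ, hU, hcov⟩ := hX 1 one_pos
  set A : ℕ → Set X := fun k => ⋃ j ∈ {j | dim j = k}, U j with hA
  have hAU : ⋃ k, A k = ⋃ j, U j := by
    ext x
    simp only [hA, mem_iUnion, Set.mem_ofPred_eq]
    exact ⟨fun ⟨_, j, _, hj⟩ => ⟨j, hj⟩, fun ⟨j, hj⟩ => ⟨dim j, j, rfl, hj⟩⟩
  refine ⟨{
    part := disjointed A
    measurableSet_part := fun k => MeasurableSet.disjointed (fun k =>
      MeasurableSet.biUnion (to_countable _) fun j _ => (hU j).1.measurableSet) k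
    disjoint_part := disjoint_disjointed A
    measure_compl_part := by rwa [iUnion_disjointed, hAU]
    rectifiable := fun k => ?_ }⟩
  have h : ∀ j, ∃ (W : Set X) (θ : X → Euc k), IsRectifiableChart m W θ ∧ (dim j = k → W = U j) := by
    intro j
    by_cases hj : dim j = k
    · subst hj
      exact ⟨U j, φ j, (hU j).1, fun _ => rfl⟩
    -- Charts of the wrong dimension are replaced by empty ones, so that the family stays indexed by
    -- `ℕ`.
    · exact ⟨∅, fun _ => 0, isRectifiableChart_empty m _, fun h => absurd h hj⟩
  choose W θ hW hWU using h
  refine ⟨W, θ, hW, ?_⟩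
  rw [sdiff_eq_empty.2, measure_empty]
  refine (disjointed_subset A k).trans (iUnion₂_subset fun j hj => ?_)
  rw [← hWU j hj]
  exact subset_iUnion W j

theorem StronglyRectifiable.nonempty_atlas (hX : StronglyRectifiable m) :
    Nonempty (Atlas m) := by
  obtain ⟨dim, U, φ, hU, hcov⟩ := hX 1 one_pos
  have hext : ∀ j, ∃ ψ : X → Euc (dim j), (∃ C, LipschitzWith C ψ) ∧ EqOn (φ j) ψ (U j) := by
    intro j
    obtain ⟨ψ, hψ, he⟩ := (hU j).2.lipschitzOnWith.extend_finite_dimension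
    exact ⟨ψ, ⟨_, hψ⟩, he⟩
  choose ψ hψ hψφ using hext
  have hVU : ∀ j, disjointed U j ⊆ U j := disjointed_subset U
  refine ⟨{
    -- Weak charts have positive measure, so pieces that become null after disjointing are dropped.
    ι := {j : ℕ // 0 < m (disjointed U j)}
    countable_ι := inferInstance
    dom := fun j => disjointed U j
    dim := fun j => dim j
    chart := fun j => ψ j
    isWeakChart := fun j => (((hU j).1.congr (hψφ j).symm).mono (hVU j)
      (MeasurableSet.disjointed (fun i => (hU i).1.measurableSet) _)).isWeakChart j.2 (hψ j)
    disjoint_dom := fun i j hij => disjoint_disjointed U (fun h => hij (Subtype.ext h))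
    measure_compl_dom := ?_ }⟩
  have hnull : m (⋃ j ∈ {j | m (disjointed U j) = 0}, disjointed U j) = 0 :=
    (measure_biUnion_null_iff (to_countable _)).2 fun j hj => hj
  refine measure_mono_null ?_ (measure_union_null hcov hnull)
  intro x hx
  by_cases hxU : x ∈ ⋃ j, U j
  · right
    rw [← iUnion_disjointed] at hxU
    obtain ⟨j, hj⟩ := mem_iUnion.1 hxU
    refine mem_biUnion (x := j) ?_ hj
    by_contra h0
    exact hx (mem_iUnion.2 ⟨⟨j, pos_iff_ne_zero.2 h0⟩, hj⟩)
  · exact Or.inl hxU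

end Existence

/-! ### Isomorphism of the two tangent modules. -/

section Isomorphism

variable {X : Type*} [MetricSpace X] [MeasurableSpace X] [BorelSpace X] {m : Measure X}

theorem StronglyRectifiable.exists_fiberwise_isometry [SFinite m] (hX : StronglyRectifiable m)
    {k l : ℕ} {U A : Set X} {φ : X → Euc k} (hU : IsWeakChart m U φ)
    (hA : IsRectifiableSet m l A) :
    ∃ (S : X → Euc l →ₗ[ℝ] Euc k) (T : X → Euc k → Euc l),
      (∀ v, Measurable v → Measurable fun x => S x (v x)) ∧
      (∀ v, Measurable v → Measurable fun x => T x (v x)) ∧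
      ∀ᵐ x ∂m, x ∈ A → x ∈ U → (∀ c, T x (S x c) = c) ∧ (∀ ξ, S x (T x ξ) = ξ) ∧
        ∀ c, tangentNorm U φ x (S x c) = ‖c‖ₑ := by
  by_cases hkl : l = k
  · subst hkl
    obtain ⟨C, hφ⟩ := hU.lipschitz
    obtain ⟨S, T, hS, hT, h⟩ := exists_measurable_isometry
      (N := fun x ξ => tangentNorm U φ x ξ) (fun v hv => measurable_tangentNorm U hφ hv)
      (G := {x | ∃ R : Euc l ≃L[ℝ] Euc l, ∀ ξ, tangentNorm U φ x (R ξ) = ‖ξ‖ₑ}) fun _ hx => hx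
    refine ⟨S, T, hS, hT, ?_⟩
    filter_upwards [hX.ae_exists_tangentNorm_eq hU] with x hx _ hxU using h x (hx hxU)
  -- When the dimensions differ, `A ∩ U` is null and any maps serve.
  · refine ⟨fun _ => 0, fun _ _ => 0, fun _ _ => measurable_const, fun _ _ => measurable_const, ?_⟩
    filter_upwards [hU.ae_dim_eq hA] with x hx hxA hxU using absurd (hx hxU hxA) hkl

theorem StronglyRectifiable.nonempty_normedModuleIso [SFinite m] (hX : StronglyRectifiable m)
    (A : Atlas m) (D : DimensionalDecomposition m) :
    Nonempty (NormedModuleIso A.tangentBundle D.tangentBundleGH) := by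
  choose S T hS hT h using fun (k : ℕ) (i : A.ι) =>
    hX.exists_fiberwise_isometry (A.isWeakChart i) (D.rectifiable k)
  -- The frames map the Euclidean fibers linearly into the concrete ones, so the isomorphism is
  -- built in this direction and then inverted.
  exact (MeasurableBundle.nonempty_normedModuleIso (B := D.tangentBundleGH)
    (B' := A.tangentBundle) S (fun i k => T k i) hS (fun i k => hT k i) h).map
    NormedModuleIso.symm

end Isomorphism

theorem sigmaFinite_of_isBounded_lt_top {X : Type*} [MetricSpace X] [SecondCountableTopology X]
    [MeasurableSpace X] {m : Measure X}
    (hm : ∀ s : Set X, Bornology.IsBounded s → m s < ⊤) : SigmaFinite m := by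
  have : IsLocallyFiniteMeasure m :=
    ⟨fun x => ⟨Metric.ball x 1, Metric.ball_mem_nhds x one_pos, hm _ Metric.isBounded_ball⟩⟩
  infer_instance

end ConcreteTangent

end

theorem theorem1p5 {X : Type*} [MetricSpace X] [CompleteSpace X] [SecondCountableTopology X]
    [MeasurableSpace X] [BorelSpace X] (m : MeasureTheory.Measure X)
    (hm : ∀ s : Set X, Bornology.IsBounded s → m s < ⊤)
    (hX : ConcreteTangent.StronglyRectifiable m) :
    Nonempty (ConcreteTangent.Atlas m) ∧
    Nonempty (ConcreteTangent.DimensionalDecomposition m) ∧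
    ∀ (A : ConcreteTangent.Atlas m) (D : ConcreteTangent.DimensionalDecomposition m),
      Nonempty (ConcreteTangent.NormedModuleIso A.tangentBundle D.tangentBundleGH) := by
  have := ConcreteTangent.sigmaFinite_of_isBounded_lt_top hm
  exact ⟨hX.nonempty_atlas, hX.nonempty_dimensionalDecomposition, hX.nonempty_normedModuleIso⟩
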